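/- Let $V(t)$, $t\ge 0$, be the continuous-time simple symmetric random walk on $\mathbb{Z}$, i.e. the compound Poisson process with characteristic function $\mathrm{E}[e^{izV(t)}]=\exp(t(\cos z-1))$ (started at $0$, càdlàg paths). Let $N\ge 1$, let $\mathbf{V}=(V_1,\dots,V_N)$ consist of $N$ independent copies of $V$, and for $\mathbf{x}\in\mathbb{Z}^N$ let $\mathrm{P}_{\mathbf{x}}$ be the law of $\mathbf{x}+\mathbf{V}$. Put $\mathbb{W}_N=\{\mathbf{x}: x_1<\cdots<x_N\}$, $\tau=\inf\{t\ge 0:\mathbf{V}(t)\notin\mathbb{W}_N\}$ and $h(\mathbf{x})=\det_{1\le j,k\le N}[x_j^{k-1}]$. The noncolliding random walk started at $\mathbf{u}=(u_1,\dots,u_N)\in\mathbb{Z}^N\cap\mathbb{W}_N$ is the $h$-transform of the random walk absorbed at the exit from $\mathbb{W}_N$, i.e. the Markov process $\mathbf{X}(t)$, $t \geq 0$, in $\mathbb{Z}^N\cap\mathbb{W}_N$ with $\mathbf{X}(0)=\mathbf{u}$ and transition function $$q_t(\mathbf{x},\mathbf{y})=\mathrm{P}_{\mathbf{x}}\big(\mathbf{V}(t)=\mathbf{y},\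 \tau>t\big)\,\frac{h(\mathbf{y})}{h(\mathbf{x})}.$$ Let $\xi=\sum_{j=1}^N\delta_{u_j}$, $\Xi(t)=\sum_{j=1}^N\delta_{X_j(t)}$, let $\mathbb{P}_\xi$ be the law of $\Xi$ and $\mathbb{E}_\xi$ its expectation. For $n\in\mathbb{N}_0$ and $z\in\mathbb{R}$ let $I_n(z)=(z/2)^n\sum_{\ell=0}^\infty\frac{(z/2)^{2\ell}}{\ell!\,\Gamma(n+\ell+1)}$ be the modified Bessel function, and for $(s,x),(t,y)\in[0,\infty)\times\mathbb{Z}$ define $$\mathbb{K}_\xi(s,x;t,y)=\sum_{j=1}^N I_{|x-u_j|}(s)I_{|y-u_j|}(-t)+\sum_{j=1}^N\ \sum_{w\in\mathbb{Z}\setminus\{u_k\}_{k=1}^N} I_{|x-u_j|}(s)I_{|y-w|}(-t)\prod_{\substack{1\le\ell\le N\\ \ell\ne j}}\frac{w-u_\ell}{u_j-u_\ell}-\mathbf{1}(s>t)I_{|x-y|}(s-t).$$ Theorem. For every $N\ge 1$ and all integers $u_1<\cdots<u_N$, the series in the definition of $\mathbb{K}_\xi$ converge absolutely, and the process $(\Xi(t),\mathbb{P}_\xi)$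 is determinantal with correlation kernel $\mathbb{K}_\xi$. That is, for all $M$, all times $0\le t_1<\cdots<t_M$ and all functions $f_1,\dots,f_M:\mathbb{Z}\to\mathbb{R}$ with $\mathbb{E}_\xi[\exp\sum_m\int f_m^+\,d\Xi(t_m)]<\infty$ (in particular for all $f_m$ that are bounded above), the moment generating function equals the Fredholm determinant, with $\chi_m=e^{f_m}-1$: $$\mathbb{E}_\xi\Big[\exp\sum_{m=1}^M\int_{\mathbb{Z}} f_m\,d\Xi(t_m)\Big]=\sum_{\substack{N_m\ge 0,\\ 1\le m\le M}}\ \sum_{\substack{\mathbf{x}^{(m)}\in\mathbb{Z}^{N_m}\cap\mathbb{W}_{N_m},\\ 1\le m\le M}}\ \prod_{m=1}^M\prod_{j=1}^{N_m}\chi_m\big(x_j^{(m)}\big)\det_{\substack{1\le j\le N_m,\,1\le k\le N_n,\\ 1\le m,n\le M}}\Big[\mathbb{K}_\xi\big(t_m,x_j^{(m)};t_n,x_k^{(n)}\big)\Big],$$ the sum being absolutely convergent; and for all $N_m\ge0$ and all $\mathbf{x}^{(m)}\in\mathbb{Z}^{N_m}\cap\mathbb{W}_{N_m}$ the spatio-temporal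 correlation functions are $$\mathbb{E}_\xi\Big[\prod_{m=1}^M\prod_{j=1}^{N_m}\Xi(t_m,\{x_j^{(m)}\})\Big]=\det_{\substack{1\le j\le N_m,\,1\le k\le N_n,\\ 1\le m,n\le M}}\Big[\mathbb{K}_\xi\big(t_m,x_j^{(m)};t_n,x_k^{(n)}\big)\Big].$$ -/

import Mathlib

open MeasureTheory ProbabilityTheory Filter Topology
open scoped NNReal ENNReal

noncomputable section

namespace NoncollidingRW

/-! ### The modified Bessel function of the first kind and the correlation kernel -/

/-- The modified Bessel function of the first kind `I_ν(z)`, for an order `ν ∈ {0, 1, 2, …}` and a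
real argument `z` of any sign. -/
def besselI (ν : ℕ) (z : ℝ) : ℝ :=
  (z / 2) ^ ν * ∑' l : ℕ, (z / 2) ^ (2 * l) / (l.factorial * Real.Gamma (ν + l + 1))

/-- The power series that defines `I_ν(z)` converges absolutely for every real `z`. -/
theorem besselI_summable (ν : ℕ) (z : ℝ) :
    Summable fun l : ℕ => (z / 2) ^ (2 * l) / (l.factorial * Real.Gamma (ν + l + 1)) := by
  have h := Real.summable_pow_div_factorial ((z / 2) ^ 2)
  refine Summable.of_nonneg_of_le (fun l => ?_) (fun l => ?_) h
  · have hG : 0 < Real.Gamma ((ν : ℝ) + l + 1) := Real.Gamma_pos_of_pos (by positivity)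
    have : 0 ≤ (z / 2) ^ (2 * l) := by rw [pow_mul]; positivity
    positivity
  · have hG : Real.Gamma ((ν : ℝ) + l + 1) = ((ν + l).factorial : ℝ) := by
      rw [← Real.Gamma_nat_eq_factorial]; push_cast; rfl
    rw [hG, pow_mul]
    have h1 : (1 : ℝ) ≤ ((ν + l).factorial : ℝ) := by exact_mod_cast (ν + l).factorial_pos
    have h2 : (0 : ℝ) < (l.factorial : ℝ) := by exact_mod_cast l.factorial_pos
    exact div_le_div_of_nonneg_left (by positivity) h2 (le_mul_of_one_le_right h2.le h1)

/-- The product `∏_{ℓ ≠ j} (w - u_ℓ) / (u_j - u_ℓ)`. -/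
def lagrangeProd {N : ℕ} (u : Fin N → ℤ) (j : Fin N) (w : ℤ) : ℝ :=
  ∏ l ∈ Finset.univ.erase j, ((w : ℝ) - u l) / ((u j : ℝ) - u l)

/-- The summands of the inner series of the kernel, over `w ∈ ℤ ∖ {u_1, …, u_N}`. -/
def kernelSummand {N : ℕ} (u : Fin N → ℤ) (j : Fin N) (s : ℝ≥0) (x : ℤ) (t : ℝ≥0) (y : ℤ)
    (w : {w : ℤ // w ∉ Set.range u}) : ℝ :=
  besselI (x - u j).natAbs s * besselI (y - w.1).natAbs (-(t : ℝ)) * lagrangeProd u j w.1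

/-- The spatio-temporal correlation kernel `K_ξ(s, x; t, y)`, `ξ = ∑_j δ_{u_j}`. -/
def besselKernel {N : ℕ} (u : Fin N → ℤ) (s : ℝ≥0) (x : ℤ) (t : ℝ≥0) (y : ℤ) : ℝ :=
  ∑ j, besselI (x - u j).natAbs s * besselI (y - u j).natAbs (-(t : ℝ))
    + ∑ j, ∑' w : {w : ℤ // w ∉ Set.range u}, kernelSummand u j s x t y w
    - (if t < s then besselI (x - y).natAbs ((s : ℝ) - t) else 0)

/-! ### The continuous-time simple symmetric random walk -/

/-- `V` is a continuous-time simple symmetric random walk on `ℤ` started at `0`: the compound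
Poisson process with jump rate `1` and jump law `(δ_{-1} + δ_1) / 2`, i.e. a process started at `0`,
with independent increments, with càdlàg paths, and such that `V t - V s` has characteristic
function `z ↦ exp ((t - s) (cos z - 1))`. -/
structure IsRW {Ω : Type*} [MeasurableSpace Ω] (P : Measure Ω) (V : ℝ≥0 → Ω → ℤ) : Prop where
  measurable : ∀ t, Measurable (V t)
  start : ∀ᵐ ω ∂P, V 0 ω = 0
  indepIncrements : HasIndepIncrements V P
  charFun_increment : ∀ s t : ℝ≥0, s ≤ t → ∀ z : ℝ,
    charFun (P.map fun ω => ((V t ω - V s ω : ℤ) : ℝ)) z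
      = Complex.exp (((t : ℂ) - s) * (Complex.cos z - 1))
  cadlag : ∀ᵐ ω ∂P, ∀ t, ContinuousWithinAt (fun r => V r ω) (Set.Ici t) t ∧
    ∃ l : ℤ, Tendsto (fun r => V r ω) (𝓝[<] t) (𝓝 l)

/-- `V` is an `N`-dimensional random walk started at the origin: its coordinates are independent
copies of the random walk on `ℤ`. The walk started at `x` is `t ↦ x + V t`. -/
structure IsRWVector {N : ℕ} {Ω : Type*} [MeasurableSpace Ω] (P : Measure Ω)
    (V : ℝ≥0 → Ω → Fin N → ℤ) : Prop where
  coord : ∀ j, IsRW P fun t ω => V t ω j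
  indep : iIndepFun (fun (j : Fin N) (ω : Ω) (t : ℝ≥0) => V t ω j) P

/-! ### The noncolliding random walk -/

/-- The points of `ℤ^N` in the Weyl chamber `x_1 < ⋯ < x_N`. -/
def weylChamber (N : ℕ) : Set (Fin N → ℤ) := {x | StrictMono x}

/-- The exit time `inf {t ≥ 0 : v(t) ∉ W_N}` of a path, with `inf ∅ = ∞`. -/
def exitTime {N : ℕ} (v : ℝ≥0 → Fin N → ℤ) : ℝ≥0∞ :=
  ⨅ (t : ℝ≥0) (_ : v t ∉ weylChamber N), (t : ℝ≥0∞)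

/-- The Vandermonde determinant `h(x) = det [x_j^{k-1}]`. -/
def vandermondeDet {N : ℕ} (x : Fin N → ℤ) : ℝ :=
  (Matrix.vandermonde fun j => (x j : ℝ)).det

/-- The transition function `P_x(V(t) = y, τ_x > t)` of the random walk absorbed at the exit from
the Weyl chamber. -/
def absorbedTransition {N : ℕ} {Ω : Type*} [MeasurableSpace Ω] (P : Measure Ω)
    (V : ℝ≥0 → Ω → Fin N → ℤ) (t : ℝ≥0) (x y : Fin N → ℤ) : ℝ :=
  P.real {ω | x + V t ω = y ∧ (t : ℝ≥0∞) < exitTime fun s => x + V s ω}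

/-- The transition function of Doob's `h`-transform of the absorbed random walk. -/
def hTransition {N : ℕ} {Ω : Type*} [MeasurableSpace Ω] (P : Measure Ω)
    (V : ℝ≥0 → Ω → Fin N → ℤ) (t : ℝ≥0) (x y : Fin N → ℤ) : ℝ :=
  absorbedTransition P V t x y * (vandermondeDet y / vandermondeDet x)

/-- `X` is a (labeled) noncolliding random walk started at `u`: the Markov process in the Weyl
chamber with `X(0) = u` whose transition function is the Doob `h`-transform, by the Vandermonde
determinant, of the random walk (realized by `V`) absorbed at the exit from the chamber. -/
structure IsNoncollidingRW {N : ℕ} {Ω : Type*} [MeasurableSpace Ω] (P : Measure Ω)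
    (V : ℝ≥0 → Ω → Fin N → ℤ) (u : Fin N → ℤ) {Ω' : Type*} [MeasurableSpace Ω']
    (P' : Measure Ω') (X : ℝ≥0 → Ω' → Fin N → ℤ) : Prop where
  measurable : ∀ t, Measurable (X t)
  mem_chamber : ∀ᵐ ω ∂P', ∀ t, X t ω ∈ weylChamber N
  start : ∀ᵐ ω ∂P', X 0 ω = u
  markov : ∀ (M : ℕ) (t : Fin (M + 1) → ℝ≥0), StrictMono t → t 0 = 0 →
    ∀ x : Fin (M + 1) → Fin N → ℤ, x 0 = u → (∀ m, x m ∈ weylChamber N) →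
      P'.real {ω | ∀ m, X (t m) ω = x m}
        = ∏ m : Fin M, hTransition P V (t m.succ - t m.castSucc) (x m.castSucc) (x m.succ)

/-- The unlabeled configuration `Ξ(t) = ∑_j δ_{X_j(t)}`. -/
def configuration {N : ℕ} {Ω : Type*} (X : ℝ≥0 → Ω → Fin N → ℤ) (t : ℝ≥0) (ω : Ω) : Measure ℤ :=
  ∑ j, Measure.dirac (X t ω j)

/-! ### Determinantal processes -/

/-- For `M` times, a choice of a number `n m` and of a strictly increasing `n m`-tuple of sites
for each time. -/
abbrev SiteTuples (M : ℕ) : Type := Σ n : Fin M → ℕ, ∀ m, Fin (n m) ↪o ℤ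

/-- The determinant `det [K(t_m, x_j^{(m)}; t_n, x_k^{(n)})]` over all pairs `(m, j)`, `(n, k)`. -/
def kernelDet (K : ℝ≥0 → ℤ → ℝ≥0 → ℤ → ℝ) {M : ℕ} (t : Fin M → ℝ≥0) (x : SiteTuples M) : ℝ :=
  (Matrix.of fun p q : (Σ m, Fin (x.1 m)) =>
    K (t p.1) (x.2 p.1 p.2) (t q.1) (x.2 q.1 q.2)).det

/-- The spatio-temporal correlation function of a point process without multiple points: the
expectation of the product of the occupation numbers of the given sites at the given times. -/
def correlation {Ω : Type*} [MeasurableSpace Ω] (P : Measure Ω) (Ξ : ℝ≥0 → Ω → Measure ℤ)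
    {M : ℕ} (t : Fin M → ℝ≥0) (x : SiteTuples M) : ℝ :=
  ∫ ω, ∏ m, ∏ j, (Ξ (t m) ω).real {x.2 m j} ∂P

/-- The process `Ξ` (with finite configurations) is determinantal with kernel `K`: the moment
generating function of any multitime distribution is the Fredholm determinant of `K`, the series
being unconditionally convergent. The test functions are arbitrary real functions on `ℤ` for which
`E[exp ∑_m ∫ f_m⁺ dΞ(t_m)]` is finite; these include all functions that are bounded above. -/
def IsDeterminantal {Ω : Type*} [MeasurableSpace Ω] (P : Measure Ω) (Ξ : ℝ≥0 → Ω → Measure ℤ)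
    (K : ℝ≥0 → ℤ → ℝ≥0 → ℤ → ℝ) : Prop :=
  ∀ (M : ℕ) (t : Fin M → ℝ≥0), StrictMono t → ∀ f : Fin M → ℤ → ℝ,
    Integrable (fun ω => Real.exp (∑ m, ∫ x, max (f m x) 0 ∂(Ξ (t m) ω))) P →
    HasSum
      (fun x : SiteTuples M => (∏ m, ∏ j, (Real.exp (f m (x.2 m j)) - 1)) * kernelDet K t x)
      (∫ ω, Real.exp (∑ m, ∫ x, f m x ∂(Ξ (t m) ω)) ∂P)

end NoncollidingRW

end

/-!
# The noncolliding random walk is determinantal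

The proof runs through one-particle quantities only. Let `p_t(k) = e^{-t} I_{|k|}(t)`
(`rwKernel`). The generating function of the Bessel functions and the uniqueness of Fourier
coefficients give `p_s * p_t = p_{s+t}` for times of *either* sign
(`hasSum_rwKernel_mul_rwKernel`), and identify `p_t`, `t ≥ 0`, as the law of the increments of the
walk (`IsRW.measure_sub_eq`). Up to the factor `e^{s-t}`, which does not affect determinants, the
kernel of the theorem is `∑_j p_s(x - u_j) Ψ_j(t, y) - 1(s > t) p_{s-t}(x - y)` (`rwCorrKernel`),
where `Ψ_j(t, ·)` (`lagrangeHeat`) is the Lagrange polynomial `L_j` of the nodes `u` evolved by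
the heat flow to the time `-t`. Hence `Ψ_j` is space-time harmonic, and, as the flow maps a
monomial to a monic polynomial of the same degree, `det [Ψ_j(t, x_k)] = h(x) / h(u)`
(`det_lagrangeHeat`).

*Karlin–McGregor formula* (`absorbedTransition_eq_kmDet`). On a grid of mesh `ε`, the walk killed
outside the chamber has the one-step kernel `∏_j p_ε(y_j - x_j)`, while `det [p_ε(y_k - x_j)]` is
a semigroup on the chamber by the Cauchy–Binet formula (`hasSum_det_mul_det`). Inside the chamber
a nontrivial permutation costs at least two steps of the walk, so the two kernels differ by
`O(ε²)`. After `t / ε` steps the difference is `O(ε)`; along dyadic grids right-continuity of the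
paths turns the grid events into the event that the walk has not left the chamber. No strong
Markov property or reflection argument is needed.

*Hole probabilities* (`measure_hole_eq_det_rwCorrKernel`). The probability that the noncolliding
walk avoids finitely many space-time points is computed by iterating the Cauchy–Binet formula: it
is the `N × N` determinant of `δ_{jk} - ∑_p w_j(p) Ψ_k(p)`, where `w_j` (`wave`) is the amplitude
of a single particle that starts at `u_j` and is removed at the obstacles. The waves solve the
triangular linear system `w (1 + U) = a`, with `a` the amplitudes without obstacles and `U` the heat
kernel between obstacles at increasing times, and `1 + U` has determinant one, so that
the Weinstein–Aronszajn identity turns this into `det (1 - K)` over the obstacles (`det_one_sub_wave`).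

*Conclusion.* Inclusion–exclusion over the points gives the correlation functions
(`correlation_eq_kernelDet`). The moment generating function is the expectation of
`∏ (1 + χ_m(X_j(t_m)))`; expanding the product over finite subsets of the configuration and integrating
term by term gives the Fredholm determinant (`isDeterminantal_besselKernel`). The domination comes
from `1 + |e^f - 1| ≤ 2 e^{f⁺}`.
-/

noncomputable section

namespace NoncollidingRW

/-! ### Auxiliary facts on infinite sums -/

theorem hasSum_of_forall_eq {α β : Type*} [AddCommMonoid β] [TopologicalSpace β] {f g : α → β}
    {a : β} (h : ∀ x, f x = g x) (hg : HasSum g a) : HasSum f a := (funext h : f = g) ▸ hg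

theorem hasSum_prod_mul {𝕜 α β : Type*} [RCLike 𝕜] {f : α → 𝕜} {g : β → 𝕜} {a b : 𝕜}
    (hf : HasSum f a) (hg : HasSum g b) : HasSum (fun p : α × β => f p.1 * g p.2) (a * b) := by
  have h := summable_mul_of_summable_norm hf.summable.norm hg.summable.norm
  exact hf.mul hg h

/-! ### Modified Bessel functions as Laurent coefficients -/

theorem gamma_natCast_add_natCast_add_one (ν l : ℕ) :
    Real.Gamma ((ν : ℝ) + l + 1) = ((ν + l).factorial : ℝ) := by
  rw [← Real.Gamma_nat_eq_factorial]; push_cast; rfl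

theorem abs_besselI_le (ν : ℕ) (z : ℝ) :
    |besselI ν z| ≤ (|z| / 2) ^ ν / ν.factorial * Real.exp (z ^ 2 / 4) := by
  unfold besselI
  have hs : HasSum (fun l : ℕ => (z ^ 2 / 4) ^ l / l.factorial) (Real.exp (z ^ 2 / 4)) := by
    rw [Real.exp_eq_exp_ℝ]; exact NormedSpace.expSeries_div_hasSum_exp _
  rw [abs_mul, abs_pow, abs_div, abs_two, div_mul_eq_mul_div, mul_div_assoc]
  refine mul_le_mul_of_nonneg_left ?_ (by positivity)
  have hnn : ∀ l : ℕ, 0 ≤ (z / 2) ^ (2 * l) / (l.factorial * Real.Gamma (ν + l + 1)) := fun l => by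
    rw [gamma_natCast_add_natCast_add_one, pow_mul]; positivity
  rw [abs_of_nonneg (tsum_nonneg hnn)]
  refine hasSum_le (fun l => ?_) (besselI_summable ν z).hasSum (hs.div_const _)
  rw [gamma_natCast_add_natCast_add_one, pow_mul, div_pow z 2 2, div_div]
  norm_num
  gcongr
  omega

theorem besselI_nonneg (ν : ℕ) {z : ℝ} (hz : 0 ≤ z) : 0 ≤ besselI ν z := by
  unfold besselI
  refine mul_nonneg (by positivity) (tsum_nonneg fun l => ?_)
  rw [gamma_natCast_add_natCast_add_one]; positivity

/-- `ℤ × ℕ ≃ ℕ × ℕ`, the inverse being `(a, b) ↦ (a - b, min a b)`. -/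
def intProdNatEquiv : ℤ × ℕ ≃ ℕ × ℕ where
  toFun p := (p.2 + p.1.toNat, p.2 + (-p.1).toNat)
  invFun q := ((q.1 : ℤ) - q.2, min q.1 q.2)
  left_inv p := by
    ext
    · simp
    · simp; omega
  right_inv q := by
    ext
    · simp; omega
    · simp; omega

/-- A product of two terms of exponential series, indexed by `intProdNatEquiv`, is a term of the
Bessel series times a power of `w`. -/
theorem intProdNatEquiv_exp_term (x : ℂ) {w : ℂ} (hw : w ≠ 0) (k : ℤ) (l : ℕ) :
    (x * w) ^ (l + k.toNat) / ((l + k.toNat).factorial : ℂ) *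
      ((x * w⁻¹) ^ (l + (-k).toNat) / ((l + (-k).toNat).factorial : ℂ))
      = x ^ k.natAbs * (x ^ (2 * l) / ((l.factorial : ℂ) * ((k.natAbs + l).factorial : ℂ))) *
        w ^ k := by
  have hl : w⁻¹ ^ l * w ^ l = 1 := by rw [← mul_pow, inv_mul_cancel₀ hw, one_pow]
  rcases le_total 0 k with hk | hk
  · lift k to ℕ using hk
    rw [Int.toNat_natCast, Int.toNat_neg_natCast, add_zero, Int.natAbs_natCast, zpow_natCast,
      mul_pow, mul_pow, add_comm k l, pow_add w, div_mul_div_comm,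
      show x ^ (l + k) * (w ^ l * w ^ k) * (x ^ l * w⁻¹ ^ l)
        = x ^ (l + k) * x ^ l * w ^ k * (w⁻¹ ^ l * w ^ l) by ring, hl, two_mul, pow_add, pow_add]
    ring
  · obtain ⟨n, rfl⟩ : ∃ n : ℕ, k = -n := ⟨k.natAbs, by omega⟩
    rw [neg_neg, Int.toNat_natCast, Int.toNat_neg_natCast, add_zero, Int.natAbs_neg,
      Int.natAbs_natCast, zpow_neg, zpow_natCast,
      mul_pow, mul_pow, add_comm n l, pow_add w⁻¹, div_mul_div_comm,
      show x ^ l * w ^ l * (x ^ (l + n) * (w⁻¹ ^ l * w⁻¹ ^ n))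
        = x ^ l * x ^ (l + n) * w⁻¹ ^ n * (w⁻¹ ^ l * w ^ l) by ring, hl, two_mul, pow_add, pow_add,
      inv_pow]
    ring

/-- The generating function `∑_k I_{|k|}(t) w ^ k = exp (t (w + w⁻¹) / 2)`. -/
theorem hasSum_besselI (t : ℝ) {w : ℂ} (hw : w ≠ 0) :
    HasSum (fun k : ℤ => (besselI k.natAbs t : ℂ) * w ^ k)
      (Complex.exp (t / 2 * (w + w⁻¹))) := by
  have h1 : ∀ x : ℂ, HasSum (fun n : ℕ => x ^ n / (n.factorial : ℂ)) (Complex.exp x) := fun x => by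
    rw [Complex.exp_eq_exp_ℂ]; exact NormedSpace.expSeries_div_hasSum_exp _
  have h2 := hasSum_prod_mul (h1 (t / 2 * w)) (h1 (t / 2 * w⁻¹))
  rw [← Complex.exp_add, ← mul_add, ← intProdNatEquiv.hasSum_iff] at h2
  refine h2.prod_fiberwise fun k => ?_
  have h3 := (besselI_summable k.natAbs t).hasSum.mul_left ((t / 2) ^ k.natAbs)
  have h4 := (Complex.hasSum_ofReal.2 h3).mul_right (w ^ k)
  refine hasSum_of_forall_eq (fun l => ?_) h4
  refine (intProdNatEquiv_exp_term (t / 2) hw k l).trans ?_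
  rw [gamma_natCast_add_natCast_add_one]
  push_cast
  rfl

/-- A summable family on `ℤ` is determined by its Fourier series. -/
theorem eq_of_hasSum_exp {a b : ℤ → ℂ} (ha : Summable a) (hb : Summable b) {F : ℝ → ℂ}
    (hA : ∀ θ : ℝ, HasSum (fun k => a k * Complex.exp (θ * Complex.I) ^ k) (F θ))
    (hB : ∀ θ : ℝ, HasSum (fun k => b k * Complex.exp (θ * Complex.I) ^ k) (F θ)) : a = b := by
  have key : ∀ c : ℤ → ℂ, Summable c →
      (∀ θ : ℝ, HasSum (fun k => c k * Complex.exp (θ * Complex.I) ^ k) 0) → ∀ n, c n = 0 := by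
    intro c hc h n
    -- integrate the series against `e^{-inθ}` term by term over a period
    let f : ℤ → C(ℝ, ℂ) := fun k =>
      ⟨fun θ => c k * Complex.exp (((k - n : ℤ) : ℂ) * Complex.I * θ), by fun_prop⟩
    have hsum : Summable fun k => ‖(f k).restrict
        (⟨Set.uIcc 0 (2 * Real.pi), isCompact_uIcc⟩ : TopologicalSpace.Compacts ℝ)‖ := by
      refine Summable.of_nonneg_of_le (fun _ => norm_nonneg _) (fun k => ?_) hc.norm
      refine (ContinuousMap.norm_le _ (norm_nonneg _)).2 fun x => ?_
      simp only [ContinuousMap.restrict_apply, f, ContinuousMap.coe_mk, norm_mul]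
      rw [show ((k - n : ℤ) : ℂ) * Complex.I * ((x : ℝ) : ℂ)
        = ((((k - n : ℤ) : ℝ) * (x : ℝ) : ℝ) : ℂ) * Complex.I by push_cast; ring,
        Complex.norm_exp_ofReal_mul_I, mul_one]
    have h1 := intervalIntegral.hasSum_intervalIntegral_of_summable_norm hsum
    have h0 : ∀ θ : ℝ, ∑' k, f k θ = 0 := fun θ => by
      have := (h θ).mul_right (Complex.exp (-(n * θ * Complex.I)))
      rw [zero_mul] at this
      rw [← this.tsum_eq]
      refine tsum_congr fun k => ?_
      simp only [f, ContinuousMap.coe_mk]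
      rw [← Complex.exp_int_mul, mul_assoc (c k), ← Complex.exp_add]
      congr 2
      push_cast; ring
    simp only [h0, intervalIntegral.integral_zero] at h1
    have h2 : ∀ k, ∫ x in (0 : ℝ)..(2 * Real.pi), f k x
        = if k = n then (2 * Real.pi) * c n else 0 := by
      intro k
      simp only [f, ContinuousMap.coe_mk]
      rw [intervalIntegral.integral_const_mul]
      split_ifs with hk
      · subst hk
        simp; ring
      · have hne : ((k - n : ℤ) : ℂ) * Complex.I ≠ 0 :=
          mul_ne_zero (by exact_mod_cast sub_ne_zero.2 hk) Complex.I_ne_zero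
        rw [integral_exp_mul_complex hne]
        have : Complex.exp (((k - n : ℤ) : ℂ) * Complex.I * ((2 * Real.pi : ℝ) : ℂ)) = 1 := by
          rw [show ((k - n : ℤ) : ℂ) * Complex.I * ((2 * Real.pi : ℝ) : ℂ)
            = ((k - n : ℤ) : ℂ) * (2 * Real.pi * Complex.I) by push_cast; ring]
          exact Complex.exp_int_mul_two_pi_mul_I _
        rw [this]; simp
    simp only [h2] at h1
    have h3 := h1.unique (hasSum_ite_eq n _)
    have hpi : (2 * Real.pi : ℂ) ≠ 0 := by exact_mod_cast Real.two_pi_pos.ne'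
    exact (mul_eq_zero.1 h3.symm).resolve_left hpi
  funext n
  refine sub_eq_zero.1 (key (fun k => a k - b k) (ha.sub hb) (fun θ => ?_) n)
  simpa [sub_mul] using (hA θ).sub (hB θ)

/-! ### The heat kernel of the walk, at times of either sign -/

/-- The function `e^{-t} I_{|k|}(t)`. For `t ≥ 0` it is the probability that the walk makes the
increment `k` during a time `t`; the kernel at time `-t` is its inverse for the convolution. -/
def rwKernel (t : ℝ) (k : ℤ) : ℝ := Real.exp (-t) * besselI k.natAbs t

theorem rwKernel_neg_right (t : ℝ) (k : ℤ) : rwKernel t (-k) = rwKernel t k := by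
  simp [rwKernel]

theorem rwKernel_nonneg {t : ℝ} (ht : 0 ≤ t) (k : ℤ) : 0 ≤ rwKernel t k :=
  mul_nonneg (Real.exp_pos _).le (besselI_nonneg _ ht)

theorem hasSum_rwKernel_mul_zpow (t : ℝ) {w : ℂ} (hw : w ≠ 0) :
    HasSum (fun k : ℤ => (rwKernel t k : ℂ) * w ^ k)
      (Complex.exp (t / 2 * (w + w⁻¹) - t)) := by
  have h := (hasSum_besselI t hw).mul_left (Complex.exp (-t))
  rw [← Complex.exp_add] at h
  rw [show (t / 2 * (w + w⁻¹) - t : ℂ) = -t + t / 2 * (w + w⁻¹) by ring]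
  refine hasSum_of_forall_eq (fun k => ?_) h
  rw [rwKernel]
  push_cast
  ring

theorem hasSum_rwKernel_mul_exp (t θ : ℝ) :
    HasSum (fun k : ℤ => (rwKernel t k : ℂ) * Complex.exp (θ * Complex.I) ^ k)
      (Complex.exp (t * (Complex.cos θ - 1))) := by
  convert hasSum_rwKernel_mul_zpow t (Complex.exp_ne_zero (θ * Complex.I)) using 2
  rw [← Complex.exp_neg, Complex.cos, neg_mul]
  ring

/-- The kernel has exponential moments. -/
theorem summable_abs_rwKernel_mul_exp (t : ℝ) :
    Summable fun k : ℤ => |rwKernel t k| * Real.exp |(k : ℝ)| := by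
  have h0 : Summable fun n : ℕ =>
      Real.exp (-t) * Real.exp (t ^ 2 / 4) * ((|t| / 2 * Real.exp 1) ^ n / n.factorial) :=
    (Real.summable_pow_div_factorial _).mul_left _
  have hb : ∀ k : ℤ, |rwKernel t k| * Real.exp |(k : ℝ)| ≤ Real.exp (-t) * Real.exp (t ^ 2 / 4) *
      ((|t| / 2 * Real.exp 1) ^ k.natAbs / k.natAbs.factorial) := fun k => by
    rw [rwKernel, abs_mul, abs_of_pos (Real.exp_pos _)]
    calc _ ≤ Real.exp (-t) * ((|t| / 2) ^ k.natAbs / k.natAbs.factorial * Real.exp (t ^ 2 / 4))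
          * Real.exp |(k : ℝ)| := by gcongr; exact abs_besselI_le _ _
      _ = _ := by
          rw [mul_pow, ← Real.exp_nat_mul, mul_one, Nat.cast_natAbs, Int.cast_abs]; ring
  refine Summable.of_nonneg_of_le (fun k => by positivity) hb ?_
  exact Summable.of_nat_of_neg (by simpa using h0) (by simpa using h0)

theorem summable_abs_rwKernel (t : ℝ) : Summable fun k : ℤ => |rwKernel t k| :=
  Summable.of_nonneg_of_le (fun _ => abs_nonneg _)
    (fun _ => le_mul_of_one_le_right (abs_nonneg _) (Real.one_le_exp (abs_nonneg _)))
    (summable_abs_rwKernel_mul_exp t)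

theorem summable_rwKernel (t : ℝ) : Summable (rwKernel t) := (summable_abs_rwKernel t).of_abs

theorem hasSum_rwKernel (t : ℝ) : HasSum (rwKernel t) 1 := by
  have h := hasSum_rwKernel_mul_zpow t one_ne_zero
  have : (t / 2 : ℂ) * (1 + 1⁻¹) - t = 0 := by norm_num
  rw [this, Complex.exp_zero] at h
  exact_mod_cast (Complex.hasSum_ofReal (f := rwKernel t) (x := 1)).1 (by simpa using h)

theorem rwKernel_zero (k : ℤ) : rwKernel 0 k = if k = 0 then 1 else 0 := by
  have h := eq_of_hasSum_exp (a := fun k => (rwKernel 0 k : ℂ))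
    (b := fun k => if k = 0 then 1 else 0) (F := fun _ => 1)
    (Complex.hasSum_ofReal.2 (summable_rwKernel 0).hasSum).summable
    (hasSum_ite_eq 0 1).summable (fun θ => by simpa using hasSum_rwKernel_mul_exp 0 θ)
    (fun θ => by
      convert hasSum_ite_eq (0 : ℤ) (1 : ℂ) using 2
      split_ifs with hk <;> simp [hk])
  have := congrFun h k
  split_ifs at this ⊢ <;> exact_mod_cast this

/-- The semigroup property of the heat kernel, for times of either sign. -/
theorem hasSum_rwKernel_mul_rwKernel (s t : ℝ) (x y : ℤ) :
    HasSum (fun z => rwKernel s (z - x) * rwKernel t (y - z)) (rwKernel (s + t) (y - x)) := by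
  have hn : ∀ r : ℝ, Summable fun k : ℤ => ‖(rwKernel r k : ℂ)‖ := fun r => by
    simpa using summable_abs_rwKernel r
  have hmul : Summable fun p : ℤ × ℤ => (rwKernel s p.1 : ℂ) * rwKernel t p.2 :=
    (hasSum_prod_mul (hn s).of_norm.hasSum (hn t).of_norm.hasSum).summable
  let e : ℤ × ℤ ≃ ℤ × ℤ :=
    ⟨fun p => (p.2, p.1 - p.2), fun q => (q.1 + q.2, q.1), fun p => by simp, fun q => by simp⟩
  have hmul' := e.summable_iff.2 hmul
  have hconv : ∀ k : ℤ, HasSum (fun z => (rwKernel s z : ℂ) * rwKernel t (k - z))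
      (∑' z, (rwKernel s z : ℂ) * rwKernel t (k - z)) := fun k =>
    (hmul'.prod_factor k).hasSum
  have hF : ∀ θ : ℝ, HasSum (fun k => (∑' z, (rwKernel s z : ℂ) * rwKernel t (k - z)) *
      Complex.exp (θ * Complex.I) ^ k) (Complex.exp ((s + t : ℝ) * (Complex.cos θ - 1))) := by
    intro θ
    have hw0 : Complex.exp (θ * Complex.I) ≠ 0 := Complex.exp_ne_zero _
    have h1 := hasSum_rwKernel_mul_exp s θ
    have h2 := hasSum_rwKernel_mul_exp t θ
    generalize Complex.exp (θ * Complex.I) = w at h1 h2 hw0 ⊢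
    have h3 := hasSum_prod_mul h1 h2
    rw [← Complex.exp_add, ← add_mul, ← Complex.ofReal_add, ← e.hasSum_iff] at h3
    refine h3.prod_fiberwise fun k => ?_
    refine hasSum_of_forall_eq (fun z => ?_) ((hconv k).mul_right (w ^ k))
    change (rwKernel s z : ℂ) * w ^ z * (rwKernel t (k - z) * w ^ (k - z)) = _
    have : w ^ k = w ^ z * w ^ (k - z) := by rw [← zpow_add₀ hw0]; congr 1; ring
    rw [this]; ring
  have key : (fun k => ∑' z, (rwKernel s z : ℂ) * rwKernel t (k - z))
      = fun k => (rwKernel (s + t) k : ℂ) :=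
    eq_of_hasSum_exp hmul'.prod (Complex.hasSum_ofReal.2 (summable_rwKernel _).hasSum).summable hF
      (fun θ => hasSum_rwKernel_mul_exp _ θ)
  have h1 := hconv (y - x)
  rw [congrFun key (y - x)] at h1
  have h2 : HasSum (fun z => rwKernel s z * rwKernel t (y - x - z)) (rwKernel (s + t) (y - x)) := by
    rw [← Complex.hasSum_ofReal]; simpa using h1
  rw [← (Equiv.subRight x).hasSum_iff] at h2
  convert h2 using 2 with z
  simp

/-! ### Convolution of functions of exponential growth -/

/-- Growth at most `C e^{|k|}`. -/
def ExpGrowth (f : ℤ → ℝ) : Prop := ∃ C : ℝ, ∀ k : ℤ, |f k| ≤ C * Real.exp |(k : ℝ)|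

/-- The action `f ↦ ∑_w p_t(w - ·) f(w)` of the heat kernel on functions. -/
def heat (t : ℝ) (f : ℤ → ℝ) (y : ℤ) : ℝ := ∑' w, rwKernel t (w - y) * f w

theorem exp_abs_le_exp_abs_sub_mul (w y : ℤ) :
    Real.exp |(w : ℝ)| ≤ Real.exp |((w - y : ℤ) : ℝ)| * Real.exp |(y : ℝ)| := by
  rw [← Real.exp_add]
  refine Real.exp_le_exp.2 ?_
  have := abs_add_le ((w : ℝ) - y) y
  simpa using this

theorem summable_abs_rwKernel_sub_mul_exp (t : ℝ) (y : ℤ) :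
    Summable fun w : ℤ => |rwKernel t (w - y)| * Real.exp |((w - y : ℤ) : ℝ)| :=
  (Equiv.subRight y).summable_iff.2 (summable_abs_rwKernel_mul_exp t)

theorem ExpGrowth.bound {f : ℤ → ℝ} {C : ℝ} (hC : ∀ k : ℤ, |f k| ≤ C * Real.exp |(k : ℝ)|)
    (t : ℝ) (y w : ℤ) : |rwKernel t (w - y) * f w| ≤
      C * Real.exp |(y : ℝ)| * (|rwKernel t (w - y)| * Real.exp |((w - y : ℤ) : ℝ)|) := by
  have hC0 : 0 ≤ C := by simpa using (abs_nonneg _).trans (hC 0)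
  rw [abs_mul]
  calc _ ≤ |rwKernel t (w - y)| * (C * (Real.exp |((w - y : ℤ) : ℝ)| * Real.exp |(y : ℝ)|)) := by
        gcongr
        exact (hC w).trans (by gcongr; exact exp_abs_le_exp_abs_sub_mul w y)
    _ = _ := by ring

theorem ExpGrowth.summable_abs {f : ℤ → ℝ} (hf : ExpGrowth f) (t : ℝ) (y : ℤ) :
    Summable fun w => |rwKernel t (w - y) * f w| := by
  obtain ⟨C, hC⟩ := hf
  exact Summable.of_nonneg_of_le (fun _ => abs_nonneg _) (ExpGrowth.bound hC t y)
    ((summable_abs_rwKernel_sub_mul_exp t y).mul_left _)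

theorem ExpGrowth.hasSum_heat {f : ℤ → ℝ} (hf : ExpGrowth f) (t : ℝ) (y : ℤ) :
    HasSum (fun w => rwKernel t (w - y) * f w) (heat t f y) :=
  (hf.summable_abs t y).of_abs.hasSum

theorem ExpGrowth.heat {f : ℤ → ℝ} (hf : ExpGrowth f) (t : ℝ) : ExpGrowth (heat t f) := by
  have hs := hf.hasSum_heat t
  have hab := hf.summable_abs t
  obtain ⟨C, hC⟩ := hf
  refine ⟨C * ∑' k : ℤ, |rwKernel t k| * Real.exp |(k : ℝ)|, fun y => ?_⟩
  rw [← (hs y).tsum_eq]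
  have h1 := norm_tsum_le_tsum_norm (f := fun w => rwKernel t (w - y) * f w)
    (by simp only [Real.norm_eq_abs]; exact hab y)
  simp only [Real.norm_eq_abs] at h1
  have h2 : HasSum (fun w => C * Real.exp |(y : ℝ)| *
      (|rwKernel t (w - y)| * Real.exp |((w - y : ℤ) : ℝ)|))
      (C * Real.exp |(y : ℝ)| * ∑' k : ℤ, |rwKernel t k| * Real.exp |(k : ℝ)|) :=
    ((Equiv.subRight y).hasSum_iff.2 (summable_abs_rwKernel_mul_exp t).hasSum).mul_left _
  refine (h1.trans (hasSum_le (ExpGrowth.bound hC t y) (hab y).hasSum h2)).trans_eq ?_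
  ring

/-- The operators `heat t`, `t ∈ ℝ`, form a group on functions of exponential growth. -/
theorem ExpGrowth.heat_heat {f : ℤ → ℝ} (hf : ExpGrowth f) (s t : ℝ) :
    NoncollidingRW.heat s (NoncollidingRW.heat t f) = NoncollidingRW.heat (s + t) f := by
  funext x
  obtain ⟨C, hC⟩ := hf
  have hf : ExpGrowth f := ⟨C, hC⟩
  have hC0 : 0 ≤ C := by simpa using (abs_nonneg _).trans (hC 0)
  have hsum : Summable (Function.uncurry fun y w : ℤ =>
      rwKernel s (y - x) * (rwKernel t (w - y) * f w)) := by
    have h1 : Summable fun p : ℤ × ℤ => C * Real.exp |(x : ℝ)| *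
        ((|rwKernel s p.1| * Real.exp |(p.1 : ℝ)|) * (|rwKernel t p.2| * Real.exp |(p.2 : ℝ)|)) :=
      ((summable_abs_rwKernel_mul_exp s).mul_of_nonneg (summable_abs_rwKernel_mul_exp t)
        (fun _ => by positivity) (fun _ => by positivity)).mul_left _
    let e : ℤ × ℤ ≃ ℤ × ℤ := ⟨fun p => (p.1 - x, p.2 - p.1), fun q => (q.1 + x, q.2 + (q.1 + x)),
      fun p => by simp, fun q => by simp⟩
    refine Summable.of_norm_bounded (e.summable_iff.2 h1) fun p => ?_
    obtain ⟨y, w⟩ := p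
    simp only [Function.uncurry, Function.comp, e, Equiv.coe_fn_mk, Real.norm_eq_abs]
    rw [abs_mul]
    calc _ ≤ |rwKernel s (y - x)| * (C * Real.exp |(y : ℝ)| *
          (|rwKernel t (w - y)| * Real.exp |((w - y : ℤ) : ℝ)|)) := by
          gcongr; exact ExpGrowth.bound hC t y w
      _ ≤ |rwKernel s (y - x)| * (C * (Real.exp |((y - x : ℤ) : ℝ)| * Real.exp |(x : ℝ)|) *
          (|rwKernel t (w - y)| * Real.exp |((w - y : ℤ) : ℝ)|)) := by
          gcongr; exact exp_abs_le_exp_abs_sub_mul y x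
      _ = _ := by ring
  have h1 : NoncollidingRW.heat s (NoncollidingRW.heat t f) x
      = ∑' y, ∑' w, rwKernel s (y - x) * (rwKernel t (w - y) * f w) :=
    tsum_congr fun y => by rw [tsum_mul_left]; rfl
  rw [h1, ← hsum.tsum_comm]
  refine tsum_congr fun w => ?_
  have := (hasSum_rwKernel_mul_rwKernel s t x w).mul_right (f w)
  rw [← this.tsum_eq]
  exact tsum_congr fun y => by ring

theorem heat_zero (f : ℤ → ℝ) : heat 0 f = f := by
  funext y
  unfold heat
  rw [tsum_eq_single y fun w hw => by rw [rwKernel_zero, if_neg (sub_ne_zero.2 hw), zero_mul]]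
  simp [rwKernel_zero]

theorem ExpGrowth.add {f g : ℤ → ℝ} (hf : ExpGrowth f) (hg : ExpGrowth g) :
    ExpGrowth fun k => f k + g k := by
  obtain ⟨C, hC⟩ := hf
  obtain ⟨D, hD⟩ := hg
  exact ⟨C + D, fun k => (abs_add_le _ _).trans (by rw [add_mul]; exact add_le_add (hC k) (hD k))⟩

theorem ExpGrowth.const_mul {f : ℤ → ℝ} (hf : ExpGrowth f) (c : ℝ) :
    ExpGrowth fun k => c * f k := by
  obtain ⟨C, hC⟩ := hf
  exact ⟨|c| * C, fun k => by
    rw [abs_mul, mul_assoc]; exact mul_le_mul_of_nonneg_left (hC k) (abs_nonneg _)⟩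

theorem ExpGrowth.sum {ι : Type*} (s : Finset ι) {f : ι → ℤ → ℝ} (hf : ∀ i, ExpGrowth (f i)) :
    ExpGrowth fun k => ∑ i ∈ s, f i k := by
  classical
  induction s using Finset.induction_on with
  | empty => exact ⟨0, by simp⟩
  | insert a s ha ih => simpa [Finset.sum_insert ha] using (hf a).add ih

theorem expGrowth_pow (n : ℕ) : ExpGrowth fun k : ℤ => (k : ℝ) ^ n := by
  refine ⟨n.factorial, fun k => ?_⟩
  have := Real.pow_div_factorial_le_exp |(k : ℝ)| (abs_nonneg _) n
  rw [div_le_iff₀ (by positivity)] at this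
  rw [abs_pow]
  linarith

theorem heat_sum_mul {ι : Type*} (s : Finset ι) (c : ι → ℝ) {f : ι → ℤ → ℝ}
    (hf : ∀ i, ExpGrowth (f i)) (t : ℝ) (y : ℤ) :
    heat t (fun k => ∑ i ∈ s, c i * f i k) y = ∑ i ∈ s, c i * heat t (f i) y := by
  have h : HasSum (fun w => ∑ i ∈ s, c i * (rwKernel t (w - y) * f i w))
      (∑ i ∈ s, c i * heat t (f i) y) :=
    hasSum_sum fun i _ => ((hf i).hasSum_heat t y).mul_left (c i)
  rw [← h.tsum_eq]
  exact tsum_congr fun w => by rw [Finset.mul_sum]; exact Finset.sum_congr rfl fun i _ => by ring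

/-! ### The Cauchy–Binet formula for a sum over the Weyl chamber -/

theorem hasSum_pi_prod {α : Type*} {N : ℕ} {f : Fin N → α → ℝ} {a : Fin N → ℝ}
    (h : ∀ i, HasSum (f i) (a i)) :
    HasSum (fun z : Fin N → α => ∏ i, f i (z i)) (∏ i, a i) := by
  induction N with
  | zero => simp
  | succ n ih =>
    have h1 := ih fun i => h i.succ
    have h2 := hasSum_prod_mul (h 0) h1
    rw [Fin.prod_univ_succ, ← (Fin.consEquiv fun _ : Fin (n + 1) => α).hasSum_iff]
    refine hasSum_of_forall_eq (fun p => ?_) h2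
    simp [Fin.prod_univ_succ, Fin.consEquiv]

/-- The unsymmetrized Cauchy–Binet formula: the second determinant is expanded, and each term of the
expansion factorizes over the particles. -/
theorem hasSum_prod_mul_det {N : ℕ} {A B : Fin N → ℤ → ℝ} {C : Matrix (Fin N) (Fin N) ℝ}
    (h : ∀ i k, HasSum (fun z => A i z * B k z) (C i k)) :
    HasSum (fun z : Fin N → ℤ =>
      (∏ i, A i (z i)) * (Matrix.of fun k i => B k (z i)).det) C.det := by
  rw [← Matrix.det_transpose, Matrix.det_apply']
  have h1 : HasSum (fun z : Fin N → ℤ => ∑ σ : Equiv.Perm (Fin N),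
      ((Equiv.Perm.sign σ : ℤ) : ℝ) * ∏ i, (A i (z i) * B (σ i) (z i)))
      (∑ σ : Equiv.Perm (Fin N), ((Equiv.Perm.sign σ : ℤ) : ℝ) * ∏ i, C i (σ i)) :=
    hasSum_sum fun σ _ => (hasSum_pi_prod fun i => h i (σ i)).mul_left _
  refine hasSum_of_forall_eq (fun z => ?_) h1
  rw [Matrix.det_apply', Finset.mul_sum]
  refine Finset.sum_congr rfl fun σ _ => ?_
  rw [Finset.prod_mul_distrib]
  simp only [Matrix.of_apply]
  ring

/-- Every injective tuple is in exactly one way a permutation of an increasing one. -/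
theorem weylChamber_comp_perm_injective (N : ℕ) :
    Function.Injective fun p : weylChamber N × Equiv.Perm (Fin N) => p.1.1 ∘ p.2 := by
  have key : ∀ (x : weylChamber N) (σ : Equiv.Perm (Fin N)),
      σ⁻¹ = Tuple.sort (x.1 ∘ σ) := fun x σ => by
    have hx : StrictMono x.1 := x.2
    refine Tuple.eq_sort_iff.2 ⟨?_, fun i j hij h => ?_⟩
    · have : (x.1 ∘ σ) ∘ ⇑σ⁻¹ = x.1 := by funext i; simp
      rw [this]; exact hx.monotone
    · have h' : x.1 (σ (σ⁻¹ i)) = x.1 (σ (σ⁻¹ j)) := h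
      have h2 := hx.injective h'
      simp only [← Equiv.Perm.mul_apply, mul_inv_cancel, Equiv.Perm.one_apply] at h2
      exact absurd h2 hij.ne
  rintro ⟨x, σ⟩ ⟨y, τ⟩ h
  have h' : x.1 ∘ σ = y.1 ∘ τ := h
  have hσ : σ = τ := inv_injective ((key x σ).trans ((congrArg Tuple.sort h').trans (key y τ).symm))
  subst hσ
  have hxy : x = y := Subtype.ext (σ.surjective.injective_comp_right h')
  rw [hxy]

theorem mem_range_weylChamber_comp_perm {N : ℕ} {z : Fin N → ℤ} (hz : Function.Injective z) :
    z ∈ Set.range fun p : weylChamber N × Equiv.Perm (Fin N) => p.1.1 ∘ p.2 := by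
  have hs : StrictMono (z ∘ Tuple.sort z) :=
    (Tuple.monotone_sort z).strictMono_of_injective (hz.comp (Tuple.sort z).injective)
  refine ⟨(⟨_, hs⟩, (Tuple.sort z)⁻¹), ?_⟩
  funext i; simp

/-- The Cauchy–Binet (Andréief) formula. -/
theorem hasSum_det_mul_det {N : ℕ} {A B : Fin N → ℤ → ℝ} {C : Matrix (Fin N) (Fin N) ℝ}
    (h : ∀ i k, HasSum (fun z => A i z * B k z) (C i k)) :
    HasSum (fun x : weylChamber N => (Matrix.of fun i j => A i (x.1 j)).det *
      (Matrix.of fun k j => B k (x.1 j)).det) C.det := by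
  have h1 := hasSum_prod_mul_det h
  rw [← (weylChamber_comp_perm_injective N).hasSum_iff] at h1
  · refine h1.prod_fiberwise fun x => ?_
    convert hasSum_fintype _ using 1
    rw [← Matrix.det_transpose, Matrix.det_apply', Finset.sum_mul]
    refine Finset.sum_congr rfl fun σ _ => ?_
    have := Matrix.det_permute' σ (Matrix.of fun k j => B k (x.1 j))
    simp only [Function.comp, Matrix.transpose_apply, Matrix.of_apply]
    change _ = _ * ((Matrix.of fun k j => B k (x.1 j)).submatrix id σ).det
    rw [this]; ring
  · intro z hz
    have hz' : ¬ Function.Injective z := fun hi => hz (mem_range_weylChamber_comp_perm hi)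
    simp only [Function.Injective, not_forall] at hz'
    obtain ⟨i, j, hij, hne⟩ := hz'
    rw [Matrix.det_zero_of_column_eq hne (fun k => by simp [hij]), mul_zero]

/-- The Karlin–McGregor determinant `det [p_t(y_k - x_j)]`. -/
def kmDet {N : ℕ} (t : ℝ) (x y : Fin N → ℤ) : ℝ :=
  (Matrix.of fun j k => rwKernel t (y k - x j)).det

/-- The semigroup property of the Karlin–McGregor determinants on the Weyl chamber. -/
theorem hasSum_kmDet_mul_kmDet {N : ℕ} (s t : ℝ) (x y : Fin N → ℤ) :
    HasSum (fun z : weylChamber N => kmDet s x z.1 * kmDet t z.1 y) (kmDet (s + t) x y) := by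
  have := hasSum_det_mul_det (A := fun i z => rwKernel s (z - x i))
    (B := fun k z => rwKernel t (y k - z)) (C := Matrix.of fun j k => rwKernel (s + t) (y k - x j))
    fun i k => hasSum_rwKernel_mul_rwKernel s t (x i) (y k)
  refine hasSum_of_forall_eq (fun z => ?_) this
  rw [← Matrix.det_transpose (Matrix.of fun k j => rwKernel t (y k - z.1 j))]
  rfl

theorem kmDet_zero {N : ℕ} {x y : Fin N → ℤ} (hx : x ∈ weylChamber N) (hy : y ∈ weylChamber N) :
    kmDet 0 x y = if x = y then 1 else 0 := by
  have hx' : StrictMono x := hx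
  have hy' : StrictMono y := hy
  split_ifs with h
  · subst h
    rw [kmDet, show (Matrix.of fun j k => rwKernel 0 (x k - x j)) = 1 from ?_, Matrix.det_one]
    ext j k
    rw [Matrix.of_apply, rwKernel_zero, Matrix.one_apply]
    simp only [sub_eq_zero, hx'.injective.eq_iff, eq_comm]
  · -- some `x j` is not a site of `y`, so that its row vanishes
    by_cases hr : Set.range x ⊆ Set.range y
    · refine absurd ((StrictMono.range_inj hx' hy').1 ?_) h
      refine Set.eq_of_subset_of_ncard_le hr ?_ (Set.finite_range _)
      rw [Set.ncard_range_of_injective hx'.injective, Set.ncard_range_of_injective hy'.injective]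
    · obtain ⟨_, ⟨j, rfl⟩, hj⟩ := Set.not_subset.1 hr
      refine Matrix.det_eq_zero_of_row_eq_zero j fun k => ?_
      rw [Matrix.of_apply, rwKernel_zero, if_neg]
      exact fun h0 => hj ⟨k, sub_eq_zero.1 h0⟩

/-! ### Lagrange polynomials under the heat flow -/

theorem lagrangeProd_apply_node {N : ℕ} {u : Fin N → ℤ} (hu : StrictMono u) (j k : Fin N) :
    lagrangeProd u j (u k) = if j = k then 1 else 0 := by
  have hne : ∀ l, l ≠ j → (u j : ℝ) - u l ≠ 0 := fun l hl => by
    rw [sub_ne_zero]; exact_mod_cast fun h => hl (hu.injective h).symm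
  unfold lagrangeProd
  split_ifs with h
  · subst h
    exact Finset.prod_eq_one fun l hl => div_self (hne l (Finset.ne_of_mem_erase hl))
  · exact Finset.prod_eq_zero (Finset.mem_erase.2 ⟨Ne.symm h, Finset.mem_univ k⟩) (by simp)

/-- The Lagrange polynomial has degree less than `N`. -/
theorem exists_lagrangeProd_eq_sum {N : ℕ} (u : Fin N → ℤ) (j : Fin N) :
    ∃ c : Fin N → ℝ, ∀ w : ℤ, lagrangeProd u j w = ∑ i : Fin N, c i * (w : ℝ) ^ (i : ℕ) := by
  let p : Polynomial ℝ := ∏ l ∈ Finset.univ.erase j,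
    (Polynomial.C ((u j : ℝ) - u l)⁻¹ * (Polynomial.X - Polynomial.C (u l : ℝ)))
  have hdeg : p.natDegree < N := by
    have hN : 0 < N := j.pos
    have h1 : p.natDegree ≤ ∑ l ∈ Finset.univ.erase j, 1 := by
      refine (Polynomial.natDegree_prod_le _ _).trans (Finset.sum_le_sum fun l _ => ?_)
      exact (Polynomial.natDegree_C_mul_le _ _).trans (Polynomial.natDegree_X_sub_C _).le
    rw [Finset.sum_const, Finset.card_erase_of_mem (Finset.mem_univ j), Finset.card_univ,
      Fintype.card_fin, smul_eq_mul, mul_one] at h1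
    omega
  refine ⟨fun i => p.coeff i, fun w => ?_⟩
  have h2 : lagrangeProd u j w = p.eval (w : ℝ) := by
    simp only [p, Polynomial.eval_prod, lagrangeProd]
    refine Finset.prod_congr rfl fun l _ => ?_
    simp [div_eq_inv_mul]
  rw [h2, Polynomial.eval_eq_sum_range' hdeg, Finset.sum_range]

theorem expGrowth_lagrangeProd {N : ℕ} (u : Fin N → ℤ) (j : Fin N) :
    ExpGrowth (lagrangeProd u j) := by
  obtain ⟨c, hc⟩ := exists_lagrangeProd_eq_sum u j
  rw [funext hc]
  exact ExpGrowth.sum _ fun i => (expGrowth_pow i).const_mul _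

/-- The space-time harmonic function `(t, y) ↦ ∑_w p_{-t}(w - y) L_j(w)` that starts from the
Lagrange polynomial `L_j` of the nodes `u`. -/
def lagrangeHeat {N : ℕ} (u : Fin N → ℤ) (j : Fin N) (t : ℝ) (y : ℤ) : ℝ :=
  heat (-t) (lagrangeProd u j) y

theorem expGrowth_lagrangeHeat {N : ℕ} (u : Fin N → ℤ) (j : Fin N) (t : ℝ) :
    ExpGrowth (lagrangeHeat u j t) := (expGrowth_lagrangeProd u j).heat _

/-- The functions `lagrangeHeat u j` are space-time harmonic. -/
theorem hasSum_rwKernel_mul_lagrangeHeat {N : ℕ} (u : Fin N → ℤ) (j : Fin N) (s t : ℝ) (x : ℤ) :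
    HasSum (fun y => rwKernel (t - s) (y - x) * lagrangeHeat u j t y) (lagrangeHeat u j s x) := by
  have h := (expGrowth_lagrangeHeat u j t).hasSum_heat (t - s) x
  have h2 : heat (t - s) (lagrangeHeat u j t) = lagrangeHeat u j s := by
    change heat (t - s) (heat (-t) _) = heat (-s) _
    rw [(expGrowth_lagrangeProd u j).heat_heat]
    congr 1; ring
  rwa [h2] at h

theorem lagrangeHeat_zero {N : ℕ} (u : Fin N → ℤ) (j : Fin N) :
    lagrangeHeat u j 0 = lagrangeProd u j := by
  funext y
  rw [lagrangeHeat, neg_zero, heat_zero]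

theorem summable_rwKernel_mul_pow (t : ℝ) (n : ℕ) :
    Summable fun d : ℤ => rwKernel t d * (d : ℝ) ^ n := by
  simpa using ((expGrowth_pow n).hasSum_heat t 0).summable

/-- The heat flow maps a monomial to a monic polynomial of the same degree. -/
theorem heat_pow (t : ℝ) {N : ℕ} (k : Fin N) (y : ℤ) :
    heat t (fun w => (w : ℝ) ^ (k : ℕ)) y = ∑ i : Fin N, (y : ℝ) ^ (i : ℕ) *
      (((k : ℕ).choose i : ℝ) * ∑' d : ℤ, rwKernel t d * (d : ℝ) ^ ((k : ℕ) - i)) := by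
  have h1 : HasSum (fun d : ℤ => ∑ i : Fin N, (y : ℝ) ^ (i : ℕ) *
      (((k : ℕ).choose i : ℝ) * (rwKernel t d * (d : ℝ) ^ ((k : ℕ) - i))))
      (∑ i : Fin N, (y : ℝ) ^ (i : ℕ) *
      (((k : ℕ).choose i : ℝ) * ∑' d : ℤ, rwKernel t d * (d : ℝ) ^ ((k : ℕ) - i))) :=
    hasSum_sum fun i _ => ((summable_rwKernel_mul_pow t _).hasSum.mul_left _).mul_left _
  rw [← (Equiv.subRight y).hasSum_iff] at h1
  rw [← h1.tsum_eq]
  refine tsum_congr fun w => ?_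
  have hw : (w : ℝ) = y + ((w - y : ℤ) : ℝ) := by push_cast; ring
  simp only [Function.comp, Equiv.subRight_apply]
  generalize hd : w - y = d at hw ⊢
  rw [hw, add_pow, Finset.mul_sum]
  rw [← Finset.sum_range (n := N) fun i => (y : ℝ) ^ i *
      (((k : ℕ).choose i : ℝ) * (rwKernel t d * (d : ℝ) ^ ((k : ℕ) - i)))]
  refine (Finset.sum_subset_zero_on_sdiff (Finset.range_subset_range.2 k.2) (fun i hi => ?_)
    (fun i _ => by ring))
  rw [Finset.mem_sdiff, Finset.mem_range, Finset.mem_range] at hi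
  rw [Nat.choose_eq_zero_of_lt (by omega)]; simp

theorem det_heat_pow (t : ℝ) {N : ℕ} (x : Fin N → ℤ) :
    (Matrix.of fun j k : Fin N => heat t (fun w => (w : ℝ) ^ (k : ℕ)) (x j)).det
      = vandermondeDet x := by
  let U : Matrix (Fin N) (Fin N) ℝ := Matrix.of fun i k =>
    ((k : ℕ).choose i : ℝ) * ∑' d : ℤ, rwKernel t d * (d : ℝ) ^ ((k : ℕ) - i)
  have h1 : (Matrix.of fun j k : Fin N => heat t (fun w => (w : ℝ) ^ (k : ℕ)) (x j))
      = Matrix.vandermonde (fun j => (x j : ℝ)) * U := by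
    ext j k
    rw [Matrix.of_apply, heat_pow, Matrix.mul_apply]
    rfl
  have hU : U.det = 1 := by
    rw [Matrix.det_of_isUpperTriangular]
    · refine Finset.prod_eq_one fun i _ => ?_
      simp [U, (hasSum_rwKernel t).tsum_eq]
    · intro i k hik
      have hik' : (k : ℕ) < i := hik
      simp [U, Nat.choose_eq_zero_of_lt hik']
  rw [h1, Matrix.det_mul, hU, mul_one, vandermondeDet]

theorem vandermondeDet_pos {N : ℕ} {x : Fin N → ℤ} (hx : x ∈ weylChamber N) :
    0 < vandermondeDet x := by
  rw [vandermondeDet, Matrix.det_vandermonde]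
  refine Finset.prod_pos fun i _ => Finset.prod_pos fun j hj => sub_pos.2 ?_
  exact_mod_cast (show StrictMono x from hx) (Finset.mem_Ioi.1 hj)

/-- The determinant of the functions `lagrangeHeat u k t` does not depend on time: it is the ratio
of Vandermonde determinants. -/
theorem det_lagrangeHeat {N : ℕ} {u : Fin N → ℤ} (hu : StrictMono u) (t : ℝ) (x : Fin N → ℤ) :
    (Matrix.of fun k j => lagrangeHeat u k t (x j)).det = vandermondeDet x / vandermondeDet u := by
  choose c hc using exists_lagrangeProd_eq_sum u
  have h1 : ∀ (t : ℝ) (x : Fin N → ℤ), (Matrix.of fun k j => lagrangeHeat u k t (x j)).det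
      = (Matrix.of c).det * vandermondeDet x := fun t x => by
    rw [← det_heat_pow (-t) x, ← Matrix.det_transpose (Matrix.of fun j k : Fin N => heat _ _ _),
      ← Matrix.det_mul]
    congr 1
    ext k j
    rw [Matrix.of_apply, Matrix.mul_apply, lagrangeHeat, funext (hc k),
      heat_sum_mul _ _ fun i : Fin N => expGrowth_pow i]
    rfl
  have h2 := h1 0 u
  rw [show (Matrix.of fun k j => lagrangeHeat u k 0 (u j)) = 1 from ?_, Matrix.det_one] at h2
  · rw [h1, eq_div_iff (vandermondeDet_pos hu).ne', mul_right_comm, ← h2, one_mul]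
  · ext k j
    rw [Matrix.of_apply, lagrangeHeat_zero, lagrangeProd_apply_node hu, Matrix.one_apply]

/-! ### The law of the random walk along a discrete time grid -/

theorem measure_eq_tsum_inter_preimage_singleton {Ω β : Type*} [MeasurableSpace Ω]
    [MeasurableSpace β] [MeasurableSingletonClass β] [Countable β] (P : Measure Ω) {Φ : Ω → β}
    (hΦ : Measurable Φ) (S : Set Ω) : P S = ∑' b, P (Φ ⁻¹' {b} ∩ S) := by
  have h := tsum_measure_preimage_singleton (μ := P.restrict S) (f := Φ) Set.countable_univ
    (fun b _ => hΦ (measurableSet_singleton b))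
  rw [tsum_univ (fun b => P.restrict S (Φ ⁻¹' {b}))] at h
  rw [Set.preimage_univ, Measure.restrict_apply_univ] at h
  rw [← h]
  exact tsum_congr fun b => Measure.restrict_apply (hΦ (measurableSet_singleton b))

/-- The increments of the walk are distributed according to the heat kernel. -/
theorem IsRW.measure_sub_eq {Ω : Type*} [MeasurableSpace Ω] {P : Measure Ω}
    [IsProbabilityMeasure P] {V : ℝ≥0 → Ω → ℤ} (hV : IsRW P V) {s t : ℝ≥0} (hst : s ≤ t) (k : ℤ) :
    P {ω | V t ω - V s ω = k} = ENNReal.ofReal (rwKernel ((t : ℝ) - s) k) := by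
  have hD : Measurable fun ω => V t ω - V s ω := (hV.measurable t).sub (hV.measurable s)
  set μ : Measure ℤ := P.map fun ω => V t ω - V s ω with hμ
  have : IsProbabilityMeasure μ := Measure.isProbabilityMeasure_map hD.aemeasurable
  have hsum : Summable fun k : ℤ => μ.real {k} := by
    refine ENNReal.summable_toReal ?_
    have h := measure_eq_tsum_inter_preimage_singleton μ measurable_id Set.univ
    simp only [Set.preimage_id, Set.inter_univ] at h
    rw [← h]
    exact measure_ne_top _ _
  have hF : ∀ θ : ℝ, HasSum (fun k : ℤ => (μ.real {k} : ℂ) * Complex.exp (θ * Complex.I) ^ k)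
      (Complex.exp (((t : ℝ) - s : ℝ) * (Complex.cos θ - 1))) := by
    intro θ
    have hc := hV.charFun_increment s t hst θ
    have hmap : P.map (fun ω => ((V t ω - V s ω : ℤ) : ℝ)) = μ.map (fun k : ℤ => (k : ℝ)) := by
      rw [hμ, Measure.map_map (measurable_of_countable _) hD]; rfl
    rw [hmap, charFun_apply_real, integral_map (measurable_of_countable _).aemeasurable
      (by fun_prop), integral_countable] at hc
    · push_cast
      rw [← hc]
      have hn : Summable fun k : ℤ => (μ.real {k} : ℂ) * Complex.exp (θ * Complex.I) ^ k := by
        refine Summable.of_norm ?_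
        simpa [Complex.norm_exp_ofReal_mul_I, abs_of_nonneg measureReal_nonneg] using hsum
      convert hn.hasSum using 1
      refine tsum_congr fun k => ?_
      rw [Complex.real_smul, ← Complex.exp_int_mul]
      push_cast
      congr 2; ring
    · refine Integrable.of_bound (C := 1) (measurable_of_countable _).aestronglyMeasurable
        (Eventually.of_forall fun k => ?_)
      rw [← Complex.ofReal_mul, Complex.norm_exp_ofReal_mul_I]
  have key := eq_of_hasSum_exp (Complex.hasSum_ofReal.2 hsum.hasSum).summable
    (Complex.hasSum_ofReal.2 (summable_rwKernel ((t : ℝ) - s)).hasSum).summable hF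
    (hasSum_rwKernel_mul_exp _)
  have h1 : μ.real {k} = rwKernel ((t : ℝ) - s) k := by exact_mod_cast congrFun key k
  rw [← h1, ofReal_measureReal, hμ, Measure.map_apply hD (measurableSet_singleton k)]
  rfl

/-- The probability that the walk visits given sites at the times of a grid. -/
theorem IsRW.measure_path {Ω : Type*} [MeasurableSpace Ω] {P : Measure Ω}
    [IsProbabilityMeasure P] {V : ℝ≥0 → Ω → ℤ} (hV : IsRW P V) (ε : ℝ≥0) (m : ℕ) (z : ℕ → ℤ) :
    P {ω | ∀ i ≤ m, V (i * ε) ω = z i} = if z 0 = 0 then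
      ∏ i ∈ Finset.range m, ENNReal.ofReal (rwKernel ε (z (i + 1) - z i)) else 0 := by
  split_ifs with h0
  · have hmono : Monotone fun i : ℕ => (i : ℝ≥0) * ε := fun i j hij => by
      dsimp only; gcongr
    have hind := (hV.indepIncrements.nat hmono).measure_inter_preimage_eq_mul (Finset.range m)
      (sets := fun i => {z (i + 1) - z i}) fun i _ => measurableSet_singleton _
    have hae : P {ω | ∀ i ≤ m, V (i * ε) ω = z i} = P (⋂ i ∈ Finset.range m,
        (fun ω => V (((i + 1 : ℕ) : ℝ≥0) * ε) ω - V (i * ε) ω) ⁻¹' {z (i + 1) - z i}) := by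
      refine measure_congr (eventuallyEq_set.2 ?_)
      filter_upwards [hV.start] with ω hω
      simp only [Set.mem_iInter, Finset.mem_range]
      constructor
      · intro (h : ∀ i ≤ m, V (i * ε) ω = z i) i hi
        change V (((i + 1 : ℕ) : ℝ≥0) * ε) ω - V (i * ε) ω = z (i + 1) - z i
        rw [h i hi.le, h (i + 1) hi]
      · intro h i hi
        induction i with
        | zero => rw [Nat.cast_zero, zero_mul, hω, h0]
        | succ i ih =>
          have h1 : V (((i + 1 : ℕ) : ℝ≥0) * ε) ω - V (i * ε) ω = z (i + 1) - z i := h i hi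
          rw [ih (by omega)] at h1
          exact sub_left_inj.1 h1
    rw [hae, hind]
    refine Finset.prod_congr rfl fun i _ => ?_
    have h1 := hV.measure_sub_eq (hmono (Nat.le_succ i)) (z (i + 1) - z i)
    have h2 : (((((i + 1 : ℕ) : ℝ≥0) * ε : ℝ≥0) : ℝ) - ((i * ε : ℝ≥0) : ℝ)) = ε := by
      push_cast; ring
    rw [← h2]
    exact h1
  · refine measure_mono_null (fun ω (hω : ∀ i ≤ m, V (i * ε) ω = z i) => ?_) hV.start
    intro h
    have := hω 0 (Nat.zero_le _)
    rw [Nat.cast_zero, zero_mul, h] at this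
    exact h0 this.symm

/-- The transition probability `∏_j p_t(y_j - x_j)` of `N` independent walks. -/
def freeTransition {N : ℕ} (t : ℝ) (x y : Fin N → ℤ) : ℝ := ∏ j, rwKernel t (y j - x j)

theorem freeTransition_nonneg {N : ℕ} {t : ℝ} (ht : 0 ≤ t) (x y : Fin N → ℤ) :
    0 ≤ freeTransition t x y := Finset.prod_nonneg fun _ _ => rwKernel_nonneg ht _

theorem IsRWVector.measurable {N : ℕ} {Ω : Type*} [MeasurableSpace Ω] {P : Measure Ω}
    {V : ℝ≥0 → Ω → Fin N → ℤ} (hV : IsRWVector P V) (t : ℝ≥0) : Measurable (V t) :=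
  measurable_pi_iff.2 fun j => (hV.coord j).measurable t

theorem IsRWVector.measure_path {N : ℕ} {Ω : Type*} [MeasurableSpace Ω] {P : Measure Ω}
    [IsProbabilityMeasure P] {V : ℝ≥0 → Ω → Fin N → ℤ} (hV : IsRWVector P V) (ε : ℝ≥0) (m : ℕ)
    (z : ℕ → Fin N → ℤ) :
    P {ω | ∀ i ≤ m, V (i * ε) ω = z i} = ∏ j, if z 0 j = 0 then
      ∏ i ∈ Finset.range m, ENNReal.ofReal (rwKernel ε (z (i + 1) j - z i j)) else 0 := by
  have hmeas : ∀ j : Fin N, MeasurableSet {p : ℝ≥0 → ℤ | ∀ i ≤ m, p (i * ε) = z i j} := by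
    intro j
    have : {p : ℝ≥0 → ℤ | ∀ i ≤ m, p (i * ε) = z i j}
        = ⋂ i : ℕ, ⋂ _ : i ≤ m, (fun p : ℝ≥0 → ℤ => p (i * ε)) ⁻¹' {z i j} := by
      ext p; simp
    rw [this]
    exact MeasurableSet.iInter fun i => MeasurableSet.iInter fun _ =>
      measurable_pi_apply _ (measurableSet_singleton _)
  have h := hV.indep.measure_inter_preimage_eq_mul Finset.univ fun j _ => hmeas j
  have hset : {ω | ∀ i ≤ m, V (i * ε) ω = z i} = ⋂ j ∈ (Finset.univ : Finset (Fin N)),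
      (fun (ω : Ω) (t : ℝ≥0) => V t ω j) ⁻¹' {p : ℝ≥0 → ℤ | ∀ i ≤ m, p (i * ε) = z i j} := by
    ext ω
    simp only [Set.mem_ofPred_eq, Finset.mem_univ, Set.iInter_true, Set.mem_iInter,
      Set.mem_preimage, funext_iff]
    tauto
  rw [hset, h]
  exact Finset.prod_congr rfl fun j _ => (hV.coord j).measure_path ε m fun i => z i j

theorem IsRWVector.measure_path_succ {N : ℕ} {Ω : Type*} [MeasurableSpace Ω] {P : Measure Ω}
    [IsProbabilityMeasure P] {V : ℝ≥0 → Ω → Fin N → ℤ} (hV : IsRWVector P V) (ε : ℝ≥0) (m : ℕ)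
    (x : Fin N → ℤ) (z : ℕ → Fin N → ℤ) :
    P {ω | ∀ i ≤ m + 1, x + V (i * ε) ω = z i} = P {ω | ∀ i ≤ m, x + V (i * ε) ω = z i} *
      ENNReal.ofReal (freeTransition ε (z m) (z (m + 1))) := by
  have h := fun m => hV.measure_path ε m fun i => z i - x
  simp only [eq_sub_iff_add_eq'] at h
  rw [h, h, freeTransition,
    ENNReal.ofReal_prod_of_nonneg fun _ _ => rwKernel_nonneg ε.coe_nonneg _,
    ← Finset.prod_mul_distrib]
  refine Finset.prod_congr rfl fun j _ => ?_
  split_ifs with h0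
  · rw [Finset.prod_range_succ]
    congr 3
    simp
  · simp

/-! ### Forward equation of a discrete-time chain restricted to given sets -/

/-- If the path probabilities of a discrete-time process have the Markov product form on a set `W`,
then the probabilities of staying in sets `C i ⊆ W` satisfy the forward equation. -/
theorem measure_stay_succ {Ω E : Type*} [MeasurableSpace Ω] [MeasurableSpace E]
    [MeasurableSingletonClass E] [Countable E] {P : Measure Ω} {Y : ℕ → Ω → E}
    (hY : ∀ i, Measurable (Y i)) {W : Set E} {m : ℕ} {r : E → E → ℝ≥0∞}
    (hr : ∀ z : ℕ → E, (∀ i ≤ m + 1, z i ∈ W) → P {ω | ∀ i ≤ m + 1, Y i ω = z i}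
      = P {ω | ∀ i ≤ m, Y i ω = z i} * r (z m) (z (m + 1)))
    {C : ℕ → Set E} (hC : ∀ i, C i ⊆ W) {y : E} (hy : y ∈ C (m + 1)) :
    P {ω | (∀ i ≤ m + 1, Y i ω ∈ C i) ∧ Y (m + 1) ω = y}
      = ∑' z, P {ω | (∀ i ≤ m, Y i ω ∈ C i) ∧ Y m ω = z} * r z y := by
  classical
  let Φ : Ω → Fin (m + 1) → E := fun ω i => Y i ω
  have hΦ : Measurable Φ := measurable_pi_iff.2 fun i => hY i
  have hΦa : ∀ ω a, Φ ω = a ↔ ∀ i (hi : i ≤ m), Y i ω = a ⟨i, Nat.lt_succ_of_le hi⟩ := by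
    intro ω a
    refine ⟨fun h i hi => by rw [← h], fun h => funext fun i => h i (Nat.le_of_lt_succ i.2)⟩
  have h1 : ∀ z, P {ω | (∀ i ≤ m, Y i ω ∈ C i) ∧ Y m ω = z} = ∑' a : Fin (m + 1) → E,
      if (∀ i : Fin (m + 1), a i ∈ C i) ∧ a (Fin.last m) = z then P (Φ ⁻¹' {a}) else 0 := by
    intro z
    rw [measure_eq_tsum_inter_preimage_singleton P hΦ]
    refine tsum_congr fun a => ?_
    split_ifs with ha
    · congr 1
      refine Set.inter_eq_left.2 fun ω (hω : Φ ω = a) => ?_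
      subst hω
      exact ⟨fun i hi => ha.1 ⟨i, Nat.lt_succ_of_le hi⟩, ha.2⟩
    · convert measure_empty (μ := P)
      refine Set.eq_empty_of_forall_notMem ?_
      rintro ω ⟨hω : Φ ω = a, h2, h3⟩
      subst hω
      exact ha ⟨fun i => h2 i (Nat.le_of_lt_succ i.2), h3⟩
  have h2 : P {ω | (∀ i ≤ m + 1, Y i ω ∈ C i) ∧ Y (m + 1) ω = y} = ∑' a : Fin (m + 1) → E,
      if (∀ i : Fin (m + 1), a i ∈ C i) then P (Φ ⁻¹' {a}) * r (a (Fin.last m)) y else 0 := by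
    rw [measure_eq_tsum_inter_preimage_singleton P hΦ]
    refine tsum_congr fun a => ?_
    split_ifs with ha
    · let z : ℕ → E := fun i => if h : i < m + 1 then a ⟨i, h⟩ else y
      have hz : ∀ i (hi : i ≤ m), z i = a ⟨i, Nat.lt_succ_of_le hi⟩ := fun i hi =>
        dif_pos (Nat.lt_succ_of_le hi)
      have hzm : z (m + 1) = y := dif_neg (lt_irrefl _)
      have h3 := hr z fun i hi => by
        rcases Nat.lt_or_ge i (m + 1) with h | h
        · rw [hz i (Nat.le_of_lt_succ h)]; exact hC _ (ha ⟨i, h⟩)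
        · rw [le_antisymm hi h, hzm]; exact hC _ hy
      have h4 : {ω | ∀ i ≤ m, Y i ω = z i} = Φ ⁻¹' {a} := by
        ext ω
        rw [Set.mem_preimage, Set.mem_singleton_iff, hΦa]
        exact forall₂_congr fun i hi => by rw [hz i hi]
      rw [h4, hzm, hz m le_rfl] at h3
      rw [show a (Fin.last m) = a ⟨m, Nat.lt_succ_of_le le_rfl⟩ from rfl, ← h3]
      congr 1
      ext ω
      simp only [Set.mem_inter_iff, Set.mem_preimage, Set.mem_singleton_iff, Set.mem_ofPred_eq, hΦa]
      constructor
      · rintro ⟨h5, _, h6⟩ i hi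
        rcases Nat.lt_or_ge i (m + 1) with h | h
        · rw [hz i (Nat.le_of_lt_succ h)]; exact h5 i (Nat.le_of_lt_succ h)
        · rw [le_antisymm hi h, hzm, h6]
      · intro h5
        have h6 : ∀ i (hi : i ≤ m), Y i ω = a ⟨i, Nat.lt_succ_of_le hi⟩ := fun i hi => by
          rw [← hz i hi]; exact h5 i (by omega)
        refine ⟨h6, fun i hi => ?_, by rw [h5 (m + 1) le_rfl, hzm]⟩
        rcases Nat.lt_or_ge i (m + 1) with h | h
        · rw [h6 i (Nat.le_of_lt_succ h)]; exact ha ⟨i, h⟩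
        · obtain rfl := le_antisymm hi h
          rw [h5 _ le_rfl, hzm]; exact hy
    · convert measure_empty (μ := P)
      refine Set.eq_empty_of_forall_notMem ?_
      rintro ω ⟨hω : Φ ω = a, h2, h3⟩
      subst hω
      exact ha fun i => h2 i i.2.le
  rw [h2]
  simp only [h1, ← ENNReal.tsum_mul_right]
  rw [ENNReal.tsum_comm]
  refine tsum_congr fun a => ?_
  rw [tsum_eq_single (a (Fin.last m)) fun z hz => by rw [if_neg fun h => hz h.2.symm, zero_mul]]
  simp only [and_true]
  split_ifs <;> simp

/-! ### The Karlin–McGregor formula -/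

theorem exists_inversion {N : ℕ} {σ : Equiv.Perm (Fin N)} (hσ : σ ≠ 1) :
    ∃ i j, i < j ∧ σ j < σ i := by
  by_contra! h
  have hm : StrictMono σ := fun i j hij => (h i j hij).lt_of_ne (σ.injective.ne hij.ne)
  refine hσ (Equiv.ext fun i => congrFun ((StrictMono.range_inj hm strictMono_id).1 ?_) i)
  rw [σ.surjective.range_eq, Set.range_id]

/-- A nontrivial permutation of the final positions forces at least two steps in total. -/
theorem two_le_sum_natAbs {N : ℕ} {σ : Equiv.Perm (Fin N)} (hσ : σ ≠ 1) {z y : Fin N → ℤ}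
    (hz : z ∈ weylChamber N) (hy : y ∈ weylChamber N) : 2 ≤ ∑ j, (y (σ j) - z j).natAbs := by
  obtain ⟨i, j, hij, hji⟩ := exists_inversion hσ
  have h1 : z i < z j := (show StrictMono z from hz) hij
  have h2 : y (σ j) < y (σ i) := (show StrictMono y from hy) hji
  have h3 : ∑ l ∈ {i, j}, (y (σ l) - z l).natAbs ≤ ∑ l, (y (σ l) - z l).natAbs :=
    Finset.sum_le_sum_of_subset (Finset.subset_univ _)
  rw [Finset.sum_pair hij.ne] at h3
  omega

/-- An increment `k` during a short time `ε` has probability `O(ε ^ |k|)`. -/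
theorem rwKernel_le_pow {ε : ℝ} (h0 : 0 ≤ ε) (h1 : ε ≤ 1) (k : ℤ) :
    rwKernel ε k ≤ ε ^ k.natAbs * (1 / (k.natAbs.factorial : ℝ)) := by
  have h := (le_abs_self _).trans (abs_besselI_le k.natAbs ε)
  rw [abs_of_nonneg h0] at h
  calc rwKernel ε k
      ≤ Real.exp (-ε) * ((ε / 2) ^ k.natAbs / k.natAbs.factorial * Real.exp (ε ^ 2 / 4)) :=
        mul_le_mul_of_nonneg_left h (Real.exp_pos _).le
    _ = (ε / 2) ^ k.natAbs * (1 / (k.natAbs.factorial : ℝ)) * Real.exp (-ε + ε ^ 2 / 4) := by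
        rw [Real.exp_add]; ring
    _ ≤ ε ^ k.natAbs * (1 / (k.natAbs.factorial : ℝ)) * 1 := by
        gcongr
        · linarith
        · exact Real.exp_le_one_iff.2 (by nlinarith)
    _ = _ := mul_one _

theorem summable_one_div_natAbs_factorial :
    Summable fun k : ℤ => 1 / (k.natAbs.factorial : ℝ) := by
  have h0 : Summable fun n : ℕ => 1 / (n.factorial : ℝ) := by
    simpa using Real.summable_pow_div_factorial 1
  exact Summable.of_nat_of_neg (by simpa using h0) (by simpa using h0)

theorem tsum_ofReal_weylChamber_le {N : ℕ} {f : Fin N → ℤ → ℝ} {a : Fin N → ℝ}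
    (hf : ∀ i k, 0 ≤ f i k) (h : ∀ i, HasSum (f i) (a i)) (σ : Equiv.Perm (Fin N)) :
    ∑' y : weylChamber N, ENNReal.ofReal (∏ j, f j (y.1 (σ j))) ≤ ENNReal.ofReal (∏ j, a j) := by
  have h1 := hasSum_pi_prod h
  have h2 : HasSum (fun y : Fin N → ℤ => ∏ j, f j (y (σ j))) (∏ j, a j) := by
    let e : (Fin N → ℤ) ≃ (Fin N → ℤ) :=
      ⟨fun y => y ∘ σ, fun y => y ∘ σ.symm, fun y => by ext; simp, fun y => by ext; simp⟩
    rw [← e.hasSum_iff] at h1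
    exact h1
  rw [← h2.tsum_eq, ENNReal.ofReal_tsum_of_nonneg (fun y => Finset.prod_nonneg fun j _ => hf _ _)
    h2.summable]
  exact ENNReal.tsum_comp_le_tsum_of_injective (f := ((↑) : weylChamber N → Fin N → ℤ))
    Subtype.val_injective fun y => ENNReal.ofReal (∏ j, f j (y (σ j)))

theorem hasSum_rwKernel_sub (t : ℝ) (x : ℤ) : HasSum (fun y => rwKernel t (y - x)) 1 :=
  (Equiv.subRight x).hasSum_iff.2 (hasSum_rwKernel t)

theorem kmDet_eq_sum {N : ℕ} (t : ℝ) (x y : Fin N → ℤ) : kmDet t x y =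
    ∑ σ : Equiv.Perm (Fin N), ((Equiv.Perm.sign σ : ℤ) : ℝ) * ∏ j, rwKernel t (y (σ j) - x j) := by
  rw [kmDet, ← Matrix.det_transpose, Matrix.det_apply']
  rfl

theorem enorm_sign_mul {N : ℕ} (σ : Equiv.Perm (Fin N)) {a : ℝ} (ha : 0 ≤ a) :
    ‖((Equiv.Perm.sign σ : ℤ) : ℝ) * a‖ₑ = ENNReal.ofReal a := by
  rcases Int.units_eq_one_or (Equiv.Perm.sign σ) with h | h <;>
    simp [h, Real.enorm_of_nonneg ha]

theorem tsum_enorm_kmDet_le {N : ℕ} {t : ℝ} (ht : 0 ≤ t) (x : Fin N → ℤ) :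
    ∑' y : weylChamber N, ‖kmDet t x y.1‖ₑ ≤ N.factorial := by
  calc ∑' y : weylChamber N, ‖kmDet t x y.1‖ₑ
      ≤ ∑' y : weylChamber N, ∑ σ : Equiv.Perm (Fin N),
          ENNReal.ofReal (∏ j, rwKernel t (y.1 (σ j) - x j)) := by
        refine ENNReal.tsum_le_tsum fun y => ?_
        rw [kmDet_eq_sum]
        refine (enorm_sum_le _ _).trans_eq (Finset.sum_congr rfl fun σ _ => ?_)
        exact enorm_sign_mul σ (Finset.prod_nonneg fun _ _ => rwKernel_nonneg ht _)
    _ = ∑ σ : Equiv.Perm (Fin N), ∑' y : weylChamber N,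
          ENNReal.ofReal (∏ j, rwKernel t (y.1 (σ j) - x j)) :=
        Summable.tsum_finsetSum fun _ _ => ENNReal.summable
    _ ≤ ∑ _σ : Equiv.Perm (Fin N), 1 := Finset.sum_le_sum fun σ _ => by
        have := tsum_ofReal_weylChamber_le (f := fun j k => rwKernel t (k - x j))
          (fun _ _ => rwKernel_nonneg ht _) (fun j => hasSum_rwKernel_sub t (x j)) σ
        simpa using this
    _ = N.factorial := by simp [Fintype.card_perm]

theorem tsum_freeTransition_le {N : ℕ} {t : ℝ} (ht : 0 ≤ t) (x : Fin N → ℤ) :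
    ∑' y : weylChamber N, ENNReal.ofReal (freeTransition t x y.1) ≤ 1 := by
  have := tsum_ofReal_weylChamber_le (f := fun j k => rwKernel t (k - x j))
    (fun _ _ => rwKernel_nonneg ht _) (fun j => hasSum_rwKernel_sub t (x j)) 1
  simpa [freeTransition] using this

/-- The constant in the short-time estimate `tsum_enorm_freeTransition_sub_kmDet_le`. -/
def shortTimeConst (N : ℕ) : ℝ := N.factorial * (∑' k : ℤ, 1 / (k.natAbs.factorial : ℝ)) ^ N

theorem shortTimeConst_nonneg (N : ℕ) : 0 ≤ shortTimeConst N :=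
  mul_nonneg (by positivity) (pow_nonneg (tsum_nonneg fun _ => by positivity) _)

/-- Within the chamber, the transition probabilities of independent walks and the Karlin–McGregor
determinants differ by a kernel of order `ε ^ 2`. -/
theorem tsum_enorm_freeTransition_sub_kmDet_le {N : ℕ} {ε : ℝ} (h0 : 0 ≤ ε) (h1 : ε ≤ 1)
    {z : Fin N → ℤ} (hz : z ∈ weylChamber N) :
    ∑' y : weylChamber N, ‖freeTransition ε z y.1 - kmDet ε z y.1‖ₑ
      ≤ ENNReal.ofReal (shortTimeConst N * ε ^ 2) := by
  set G : ℝ := ∑' k : ℤ, 1 / (k.natAbs.factorial : ℝ) with hG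
  have hG0 : 0 ≤ G := tsum_nonneg fun _ => by positivity
  have hprod : ∀ (y : weylChamber N) (σ : Equiv.Perm (Fin N)), σ ≠ 1 →
      ∏ j, rwKernel ε (y.1 (σ j) - z j)
        ≤ ε ^ 2 * ∏ j, (1 / ((y.1 (σ j) - z j).natAbs.factorial : ℝ)) := by
    intro y σ hσ
    calc _ ≤ ∏ j, (ε ^ (y.1 (σ j) - z j).natAbs *
          (1 / ((y.1 (σ j) - z j).natAbs.factorial : ℝ))) :=
          Finset.prod_le_prod (fun _ _ => rwKernel_nonneg h0 _) fun j _ => rwKernel_le_pow h0 h1 _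
      _ ≤ _ := by
          rw [Finset.prod_mul_distrib, Finset.prod_pow_eq_pow_sum]
          exact mul_le_mul_of_nonneg_right
            (pow_le_pow_of_le_one h0 h1 (two_le_sum_natAbs hσ hz y.2))
            (Finset.prod_nonneg fun _ _ => by positivity)
  calc ∑' y : weylChamber N, ‖freeTransition ε z y.1 - kmDet ε z y.1‖ₑ
      ≤ ∑' y : weylChamber N, ∑ σ : Equiv.Perm (Fin N), ENNReal.ofReal (ε ^ 2) *
          ENNReal.ofReal (∏ j, (1 / ((y.1 (σ j) - z j).natAbs.factorial : ℝ))) := by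
        refine ENNReal.tsum_le_tsum fun y => ?_
        rw [kmDet_eq_sum, ← Finset.add_sum_erase _ _ (Finset.mem_univ 1)]
        have : freeTransition ε z y.1 - (((Equiv.Perm.sign (1 : Equiv.Perm (Fin N)) : ℤ) : ℝ) *
            ∏ j, rwKernel ε (y.1 ((1 : Equiv.Perm (Fin N)) j) - z j) +
            ∑ σ ∈ Finset.univ.erase (1 : Equiv.Perm (Fin N)), ((Equiv.Perm.sign σ : ℤ) : ℝ) *
              ∏ j, rwKernel ε (y.1 (σ j) - z j))
            = -∑ σ ∈ Finset.univ.erase (1 : Equiv.Perm (Fin N)), ((Equiv.Perm.sign σ : ℤ) : ℝ) *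
              ∏ j, rwKernel ε (y.1 (σ j) - z j) := by
          simp [freeTransition]
        rw [this, enorm_neg]
        refine (enorm_sum_le _ _).trans ?_
        refine (Finset.sum_le_sum fun σ hσ => ?_).trans
          (Finset.sum_le_sum_of_subset (Finset.erase_subset 1 Finset.univ))
        rw [enorm_sign_mul σ (Finset.prod_nonneg fun _ _ => rwKernel_nonneg h0 _),
          ← ENNReal.ofReal_mul (by positivity)]
        exact ENNReal.ofReal_le_ofReal (hprod y σ (Finset.ne_of_mem_erase hσ))
    _ = ∑ σ : Equiv.Perm (Fin N), ENNReal.ofReal (ε ^ 2) * ∑' y : weylChamber N,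
          ENNReal.ofReal (∏ j, (1 / ((y.1 (σ j) - z j).natAbs.factorial : ℝ))) := by
        rw [Summable.tsum_finsetSum fun _ _ => ENNReal.summable]
        simp only [ENNReal.tsum_mul_left]
    _ ≤ ∑ _σ : Equiv.Perm (Fin N), ENNReal.ofReal (ε ^ 2) * ENNReal.ofReal (G ^ N) :=
        Finset.sum_le_sum fun σ _ => by
          gcongr
          have := tsum_ofReal_weylChamber_le (N := N)
            (f := fun j k => 1 / ((k - z j).natAbs.factorial : ℝ)) (a := fun _ => G)
            (fun _ _ => by positivity) (fun j => (Equiv.subRight (z j)).hasSum_iff.2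
              summable_one_div_natAbs_factorial.hasSum) σ
          simpa using this
    _ = ENNReal.ofReal (shortTimeConst N * ε ^ 2) := by
        rw [← ENNReal.ofReal_mul (by positivity), Finset.sum_const, Finset.card_univ,
          Fintype.card_perm, Fintype.card_fin, nsmul_eq_mul, ← ENNReal.ofReal_natCast,
          ← ENNReal.ofReal_mul (by positivity), shortTimeConst]
        congr 1; ring

/-- The walk started at `x` is in the chamber at the times `0, ε, …, m ε`, and at `y` at the last
of them. -/
def gridEvent {N : ℕ} {Ω : Type*} (V : ℝ≥0 → Ω → Fin N → ℤ) (x : Fin N → ℤ) (ε : ℝ≥0) (m : ℕ)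
    (y : Fin N → ℤ) : Set Ω :=
  {ω | (∀ i : ℕ, i ≤ m → x + V (i * ε) ω ∈ weylChamber N) ∧ x + V (m * ε) ω = y}

theorem gridEvent_measure_succ {N : ℕ} {Ω : Type*} [MeasurableSpace Ω] {P : Measure Ω}
    [IsProbabilityMeasure P] {V : ℝ≥0 → Ω → Fin N → ℤ} (hV : IsRWVector P V) (ε : ℝ≥0) (m : ℕ)
    (x : Fin N → ℤ) {y : Fin N → ℤ} (hy : y ∈ weylChamber N) :
    P (gridEvent V x ε (m + 1) y) = ∑' z : weylChamber N, P (gridEvent V x ε m z.1) *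
      ENNReal.ofReal (freeTransition ε z.1 y) := by
  have h := measure_stay_succ (P := P) (Y := fun i ω => x + V (i * ε) ω) (W := weylChamber N)
    (m := m) (r := fun z y => ENNReal.ofReal (freeTransition ε z y))
    (fun i => (hV.measurable _).const_add x) (fun z _ => hV.measure_path_succ ε m x z)
    (C := fun _ => weylChamber N) (fun _ => subset_rfl) hy
  refine h.trans ?_
  rw [← tsum_subtype_eq_of_support_subset (s := weylChamber N)]
  · rfl
  · intro z hz
    by_contra hzW
    refine hz ?_
    have : {ω | (∀ i : ℕ, i ≤ m → x + V (i * ε) ω ∈ weylChamber N) ∧ x + V (m * ε) ω = z} = ∅ := by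
      refine Set.eq_empty_of_forall_notMem ?_
      rintro ω ⟨h1, h2⟩
      exact hzW (h2 ▸ h1 m le_rfl)
    simp only [this, measure_empty, zero_mul]

theorem gridEvent_measure_zero {N : ℕ} {Ω : Type*} [MeasurableSpace Ω] {P : Measure Ω}
    [IsProbabilityMeasure P] {V : ℝ≥0 → Ω → Fin N → ℤ} (hV : IsRWVector P V) (ε : ℝ≥0)
    {x y : Fin N → ℤ} (hx : x ∈ weylChamber N) :
    P (gridEvent V x ε 0 y) = if x = y then 1 else 0 := by
  have hV0 : ∀ᵐ ω ∂P, V 0 ω = 0 := by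
    filter_upwards [ae_all_iff.2 fun j => (hV.coord j).start] with ω hω
    exact funext hω
  have : P (gridEvent V x ε 0 y) = P {_ω | x = y} := by
    refine measure_congr (eventuallyEq_set.2 ?_)
    filter_upwards [hV0] with ω hω
    change ((∀ i : ℕ, i ≤ 0 → x + V (i * ε) ω ∈ weylChamber N) ∧ x + V ((0 : ℕ) * ε) ω = y) ↔ x = y
    simp [hω, hx]
  rw [this]
  split_ifs with h <;> simp [h]

/-- The error of the Karlin–McGregor formula on a grid is at most linear in the number of steps and
quadratic in the mesh. -/
theorem tsum_enorm_gridEvent_sub_kmDet_le {N : ℕ} {Ω : Type*} [MeasurableSpace Ω] {P : Measure Ω}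
    [IsProbabilityMeasure P] {V : ℝ≥0 → Ω → Fin N → ℤ} (hV : IsRWVector P V) {ε : ℝ≥0}
    (hε : (ε : ℝ) ≤ 1) {x : Fin N → ℤ} (hx : x ∈ weylChamber N) (m : ℕ) :
    ∑' y : weylChamber N, ‖P.real (gridEvent V x ε m y.1) - kmDet (m * ε) x y.1‖ₑ
      ≤ m * (N.factorial * ENNReal.ofReal (shortTimeConst N * (ε : ℝ) ^ 2)) := by
  induction m with
  | zero =>
    refine le_of_eq ?_
    simp only [Nat.cast_zero, zero_mul, ENNReal.tsum_eq_zero]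
    intro y
    rw [measureReal_def, gridEvent_measure_zero hV ε hx, kmDet_zero hx y.2]
    split_ifs <;> simp
  | succ m ih =>
    set K := ENNReal.ofReal (shortTimeConst N * (ε : ℝ) ^ 2)
    let F : weylChamber N → ℝ := fun z => P.real (gridEvent V x ε m z.1)
    let D : weylChamber N → ℝ := fun z => kmDet (m * ε) x z.1
    let R : weylChamber N → weylChamber N → ℝ := fun z y => freeTransition ε z.1 y.1
    have hR0 : ∀ z y, 0 ≤ R z y := fun z y => freeTransition_nonneg ε.coe_nonneg _ _
    have hF : ∀ y : weylChamber N, HasSum (fun z => F z * R z y)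
        (P.real (gridEvent V x ε (m + 1) y.1)) := by
      intro y
      have h1 := gridEvent_measure_succ hV ε m x y.2
      have hne := h1 ▸ measure_ne_top P (gridEvent V x ε (m + 1) y.1)
      have h2 := ENNReal.hasSum_toReal hne
      rw [measureReal_def, h1, ENNReal.tsum_toReal_eq fun z => ENNReal.ne_top_of_tsum_ne_top hne z]
      refine hasSum_of_forall_eq (fun z => ?_) h2
      rw [ENNReal.toReal_mul, ENNReal.toReal_ofReal (hR0 z y)]
      rfl
    have hD : ∀ y : weylChamber N, HasSum (fun z : weylChamber N => D z * kmDet ε z.1 y.1)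
        (kmDet ((m + 1 : ℕ) * ε) x y.1) := by
      intro y
      have := hasSum_kmDet_mul_kmDet (m * ε) ε x y.1
      convert this using 2
      push_cast; ring
    have hstep : ∀ y : weylChamber N,
        ‖P.real (gridEvent V x ε (m + 1) y.1) - kmDet ((m + 1 : ℕ) * ε) x y.1‖ₑ
          ≤ ∑' z, (‖F z - D z‖ₑ * ENNReal.ofReal (R z y) +
            ‖D z‖ₑ * ‖R z y - kmDet ε z.1 y.1‖ₑ) := by
      intro y
      rw [← ((hF y).sub (hD y)).tsum_eq]
      refine enorm_tsum_le_tsum_enorm.trans (ENNReal.tsum_le_tsum fun z => ?_)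
      rw [show F z * R z y - D z * kmDet ε z.1 y.1
        = (F z - D z) * R z y + D z * (R z y - kmDet ε z.1 y.1) by ring]
      refine (enorm_add_le _ _).trans_eq ?_
      rw [enorm_mul, enorm_mul, Real.enorm_of_nonneg (hR0 z y)]
    -- the old error is transported by a sub-Markov kernel, the new one is that of a single step
    calc _ ≤ ∑' y, ∑' z, (‖F z - D z‖ₑ * ENNReal.ofReal (R z y) +
            ‖D z‖ₑ * ‖R z y - kmDet ε z.1 y.1‖ₑ) := ENNReal.tsum_le_tsum hstep
      _ = ∑' z, (‖F z - D z‖ₑ * ∑' y, ENNReal.ofReal (R z y) +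
            ‖D z‖ₑ * ∑' y : weylChamber N, ‖R z y - kmDet ε z.1 y.1‖ₑ) := by
          rw [ENNReal.tsum_comm]
          refine tsum_congr fun z => ?_
          rw [ENNReal.tsum_add, ENNReal.tsum_mul_left, ENNReal.tsum_mul_left]
      _ ≤ ∑' z, (‖F z - D z‖ₑ * 1 + ‖D z‖ₑ * K) := by
          refine ENNReal.tsum_le_tsum fun z => ?_
          gcongr
          · exact tsum_freeTransition_le ε.coe_nonneg _
          · exact tsum_enorm_freeTransition_sub_kmDet_le ε.coe_nonneg hε z.2
      _ ≤ m * (N.factorial * K) + N.factorial * K := by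
          rw [ENNReal.tsum_add, ENNReal.tsum_mul_right, ENNReal.tsum_mul_right, mul_one]
          gcongr
          exact tsum_enorm_kmDet_le (by positivity) x
      _ = _ := by push_cast; ring

/-- For right-continuous paths, staying in the chamber up to time `t` is seen on the dyadic
grids. -/
theorem iInter_gridEvent {N : ℕ} {v : ℝ≥0 → Fin N → ℤ}
    (hv : ∀ j t, ContinuousWithinAt (fun r => v r j) (Set.Ici t) t) (x : Fin N → ℤ) (t : ℝ≥0) :
    (∀ n : ℕ, ∀ i : ℕ, i ≤ 2 ^ n → x + v (i * (t / 2 ^ n)) ∈ weylChamber N) ↔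
      (t : ℝ≥0∞) < exitTime fun s => x + v s := by
  have hconst : ∀ s, ∀ᶠ r in 𝓝[≥] s, v r = v s := fun s => by
    have : ∀ j, ∀ᶠ r in 𝓝[≥] s, v r j = v s j := fun j =>
      hv j s ((isOpen_discrete {v s j}).mem_nhds rfl)
    filter_upwards [eventually_all.2 this] with r hr using funext hr
  have hball : ∀ s, ∃ δ > s, ∀ r, s ≤ r → r < δ → v r = v s := fun s => by
    obtain ⟨δ, hδ, h⟩ := (mem_nhdsGE_iff_exists_Ico_subset' (show s < s + 1 by simp)).1 (hconst s)
    exact ⟨δ, hδ, fun r h1 h2 => h ⟨h1, h2⟩⟩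
  constructor
  · intro h
    have hle : ∀ s ≤ t, x + v s ∈ weylChamber N := by
      intro s hs
      rcases hs.eq_or_lt with rfl | hs
      · simpa using h 0 1 le_rfl
      obtain ⟨δ, hδ, hc⟩ := hball s
      have ht : (0 : ℝ) < t := s.coe_nonneg.trans_lt (NNReal.coe_lt_coe.2 hs)
      obtain ⟨n, hn⟩ := exists_nat_gt ((t : ℝ) / (δ - s))
      have hδs : (0 : ℝ) < δ - s := sub_pos.2 (by exact_mod_cast hδ)
      have hn2 : (t : ℝ) / (δ - s) < 2 ^ n := hn.trans (by exact_mod_cast Nat.lt_two_pow_self)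
      let i := ⌈(s : ℝ) * 2 ^ n / t⌉₊
      have hi1 : (s : ℝ) * 2 ^ n / t ≤ i := Nat.le_ceil _
      have hi2 : (i : ℝ) < (s : ℝ) * 2 ^ n / t + 1 := Nat.ceil_lt_add_one (by positivity)
      have hi3 : i ≤ 2 ^ n := by
        refine Nat.ceil_le.2 ?_
        rw [div_le_iff₀ ht]
        push_cast
        rw [mul_comm]
        gcongr
      have hr1 : s ≤ i * (t / 2 ^ n) := by
        rw [← NNReal.coe_le_coe]
        push_cast
        rw [div_le_iff₀ ht] at hi1
        rw [mul_div_assoc', le_div_iff₀ (by positivity)]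
        exact hi1
      have hr2 : i * (t / 2 ^ n) < δ := by
        rw [← NNReal.coe_lt_coe]
        push_cast
        have h1 : (t : ℝ) / 2 ^ n < δ - s := by
          rw [div_lt_iff₀ (by positivity)]
          rwa [div_lt_iff₀ hδs, mul_comm] at hn2
        calc (i : ℝ) * (t / 2 ^ n) ≤ ((s : ℝ) * 2 ^ n / t + 1) * (t / 2 ^ n) := by gcongr
          _ = s + t / 2 ^ n := by field_simp
          _ < δ := by linarith
      have := h n i hi3
      rwa [hc _ hr1 hr2] at this
    obtain ⟨δ, hδ, hc⟩ := hball t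
    refine lt_of_lt_of_le (ENNReal.coe_lt_coe.2 hδ) (le_iInf₂ fun r hr => ?_)
    refine ENNReal.coe_le_coe.2 (le_of_not_gt fun hrδ => hr ?_)
    rcases le_total r t with h1 | h1
    · exact hle r h1
    · change x + v r ∈ _
      rw [hc r h1 hrδ]; exact hle t le_rfl
  · intro h n i hi
    by_contra hcon
    have h1 : (exitTime fun s => x + v s) ≤ ((i * (t / 2 ^ n) : ℝ≥0) : ℝ≥0∞) :=
      iInf₂_le (f := fun (s : ℝ≥0) (_ : x + v s ∉ weylChamber N) => (s : ℝ≥0∞)) _ hcon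
    have h2 : (i * (t / 2 ^ n) : ℝ≥0) ≤ t := by
      calc (i * (t / 2 ^ n) : ℝ≥0) ≤ ((2 ^ n : ℕ) : ℝ≥0) * (t / 2 ^ n) := by gcongr
        _ = t := by push_cast; field_simp
    exact absurd (h.trans_le (h1.trans (ENNReal.coe_le_coe.2 h2))) (lt_irrefl _)

/-- The **Karlin–McGregor formula**. -/
theorem absorbedTransition_eq_kmDet {N : ℕ} {Ω : Type*} [MeasurableSpace Ω] {P : Measure Ω}
    [IsProbabilityMeasure P] {V : ℝ≥0 → Ω → Fin N → ℤ} (hV : IsRWVector P V) (t : ℝ≥0)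
    {x y : Fin N → ℤ} (hx : x ∈ weylChamber N) (hy : y ∈ weylChamber N) :
    absorbedTransition P V t x y = kmDet t x y := by
  let A : ℕ → Set Ω := fun n => gridEvent V x (t / 2 ^ n) (2 ^ n) y
  have hend : ∀ n : ℕ, ((2 ^ n : ℕ) : ℝ≥0) * (t / 2 ^ n) = t := fun n => by
    push_cast; field_simp
  have hA : ∀ n ω, ω ∈ A n ↔
      (∀ i : ℕ, i ≤ 2 ^ n → x + V (i * (t / 2 ^ n)) ω ∈ weylChamber N) ∧ x + V t ω = y :=
    fun n ω => by
    change (_ ∧ x + V (((2 ^ n : ℕ) : ℝ≥0) * (t / 2 ^ n)) ω = y) ↔ _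
    rw [hend]
  have hAm : ∀ n, MeasurableSet (A n) := fun n => by
    have h1 : ∀ s, Measurable fun ω => x + V s ω := fun s => (hV.measurable s).const_add x
    have : A n = (⋂ i : ℕ, ⋂ _ : i ≤ 2 ^ n, (fun ω => x + V (i * (t / 2 ^ n)) ω) ⁻¹'
        weylChamber N) ∩ (fun ω => x + V t ω) ⁻¹' {y} := by
      ext ω; rw [hA]; simp
    rw [this]
    exact (MeasurableSet.iInter fun i => MeasurableSet.iInter fun _ =>
      h1 _ (Set.to_countable _).measurableSet).inter (h1 _ (measurableSet_singleton _))
  have hanti : Antitone A := by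
    refine antitone_nat_of_succ_le fun n ω hω => ?_
    rw [hA] at hω
    refine (hA n ω).2 ⟨fun i hi => ?_, hω.2⟩
    have := hω.1 (2 * i) (by rw [pow_succ]; omega)
    have he : ((2 * i : ℕ) : ℝ≥0) * (t / 2 ^ (n + 1)) = i * (t / 2 ^ n) := by
      push_cast; rw [pow_succ]; field_simp
    rwa [he] at this
  have hlim := tendsto_measure_iInter_atTop (μ := P) (fun n => (hAm n).nullMeasurableSet) hanti
    ⟨0, measure_ne_top _ _⟩
  -- almost surely, the limit of the grid events is the event that the walk has not left the chamber
  have hae : P (⋂ n, A n)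
      = P {ω | x + V t ω = y ∧ (t : ℝ≥0∞) < exitTime fun s => x + V s ω} := by
    refine measure_congr (eventuallyEq_set.2 ?_)
    filter_upwards [ae_all_iff.2 fun j => (hV.coord j).cadlag] with ω hω
    have h1 := iInter_gridEvent (v := fun s => V s ω) (fun j s => (hω j s).1) x t
    simp only [Set.mem_iInter, hA]
    change _ ↔ x + V t ω = y ∧ _
    rw [← h1]
    exact ⟨fun h => ⟨(h 0).2, fun n => (h n).1⟩, fun h n => ⟨h.2 n, h.1⟩⟩
  rw [hae] at hlim
  have hlim' : Tendsto (fun n => P.real (A n)) atTop (𝓝 (absorbedTransition P V t x y)) :=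
    (ENNReal.tendsto_toReal (measure_ne_top _ _)).comp hlim
  have hbound : ∀ᶠ n : ℕ in atTop, |P.real (A n) - kmDet t x y|
      ≤ N.factorial * (shortTimeConst N * (t : ℝ) ^ 2) * (1 / 2) ^ n := by
    have hev : ∀ᶠ n : ℕ in atTop, (t : ℝ) < 2 ^ n :=
      (tendsto_pow_atTop_atTop_of_one_lt (one_lt_two : (1 : ℝ) < 2)).eventually_gt_atTop _
    filter_upwards [hev] with n hn
    have hε : ((t / 2 ^ n : ℝ≥0) : ℝ) ≤ 1 := by
      push_cast
      exact (div_le_one (by positivity)).2 hn.le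
    have h1 := (ENNReal.le_tsum (⟨y, hy⟩ : weylChamber N)).trans
      (tsum_enorm_gridEvent_sub_kmDet_le hV hε hx (2 ^ n))
    have h2 : ((2 ^ n : ℕ) : ℝ) * ((t / 2 ^ n : ℝ≥0) : ℝ) = t := by exact_mod_cast hend n
    dsimp only at h1
    rw [h2, Real.enorm_eq_ofReal_abs, ← ENNReal.ofReal_natCast, ← ENNReal.ofReal_natCast,
      ← ENNReal.ofReal_mul (by positivity), ← ENNReal.ofReal_mul (by positivity)] at h1
    have hK := shortTimeConst_nonneg N
    refine ((ENNReal.ofReal_le_ofReal_iff (by positivity)).1 h1).trans_eq ?_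
    push_cast
    rw [one_div, inv_pow]
    field_simp
  have h0 : Tendsto (fun n : ℕ => N.factorial * (shortTimeConst N * (t : ℝ) ^ 2) * (1 / 2 : ℝ) ^ n)
      atTop (𝓝 0) := by
    simpa using (tendsto_pow_atTop_nhds_zero_of_lt_one (by norm_num : (0 : ℝ) ≤ 1 / 2)
      (by norm_num)).const_mul (N.factorial * (shortTimeConst N * (t : ℝ) ^ 2))
  have hlim2 : Tendsto (fun n => P.real (A n)) atTop (𝓝 (kmDet t x y)) := by
    rw [tendsto_iff_norm_sub_tendsto_zero]
    exact squeeze_zero' (Eventually.of_forall fun _ => norm_nonneg _)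
      (by simpa only [Real.norm_eq_abs] using hbound) h0
  exact tendsto_nhds_unique hlim' hlim2

/-! ### One-particle waves with obstacles -/

section Wave

variable {N : ℕ} {ι : Type*}

open scoped Classical in
/-- The indicator that `x` is none of the sites `site p` assigned to the time index `m`. -/
def freeSite (tm : ι → ℕ) (site : ι → ℤ) (m : ℕ) (x : ℤ) : ℝ :=
  if ∃ p, tm p = m ∧ site p = x then 0 else 1

/-- The amplitude with which a single particle started at `u j` arrives at a site at the time
`T m` without having been at an obstacle at an earlier one of the times `T 0, T 1, …`. The obstacle
`p` is the site `site p` at the time `T (tm p)`. -/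
def wave (u : Fin N → ℤ) (T : ℕ → ℝ) (tm : ι → ℕ) (site : ι → ℤ) : ℕ → Fin N → ℤ → ℝ
  | 0, j, x => rwKernel 0 (x - u j)
  | m + 1, j, y => ∑' x, wave u T tm site m j x *
      (freeSite tm site m x * rwKernel (T (m + 1) - T m) (y - x))

variable [Fintype ι]

theorem freeSite_eq {tm : ι → ℕ} {site : ι → ℤ}
    (hinj : ∀ p q, tm p = tm q → site p = site q → p = q) (m : ℕ) (x : ℤ) :
    freeSite tm site m x = 1 - ∑ p with tm p = m, if site p = x then 1 else 0 := by
  classical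
  unfold freeSite
  rw [← Finset.sum_filter, Finset.filter_filter, Finset.sum_const, nsmul_one]
  split_ifs with h
  · obtain ⟨p, hp⟩ := h
    rw [show (Finset.univ.filter fun q => tm q = m ∧ site q = x) = {p} from ?_]
    · simp
    · ext q
      simp only [Finset.mem_filter, Finset.mem_univ, true_and, Finset.mem_singleton]
      exact ⟨fun hq => hinj _ _ (hq.1.trans hp.1.symm) (hq.2.trans hp.2.symm), fun hq => hq ▸ hp⟩
  · rw [Finset.filter_eq_empty_iff.2 fun q _ hq => h ⟨q, hq⟩]
    simp

variable {u : Fin N → ℤ} {T : ℕ → ℝ} {tm : ι → ℕ} {site : ι → ℤ}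

/-- Integration of a wave against a function `φ` whose evolution `φ'` under the heat flow is
known. -/
theorem hasSum_wave_mul (hinj : ∀ p q, tm p = tm q → site p = site q → p = q) {m : ℕ} {j : Fin N}
    (hw : ∀ x, wave u T tm site m j x = rwKernel (T m) (x - u j) -
      ∑ p with tm p < m, wave u T tm site (tm p) j (site p) *
        rwKernel (T m - T (tm p)) (x - site p))
    {φ : ℤ → ℝ} {φ' : ℝ → ℤ → ℝ}
    (hφ : ∀ s z, HasSum (fun x => rwKernel (T m - s) (x - z) * φ x) (φ' s z)) :
    HasSum (fun x => wave u T tm site m j x * (freeSite tm site m x * φ x))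
      (φ' 0 (u j) - ∑ p with tm p ≤ m, wave u T tm site (tm p) j (site p) *
        φ' (T (tm p)) (site p)) := by
  classical
  -- the heat kernel at time `0` is the identity
  have hφm : ∀ z, φ' (T m) z = φ z := fun z => by
    refine (hφ (T m) z).unique ?_
    have := hasSum_ite_eq z (φ z)
    refine hasSum_of_forall_eq (fun x => ?_) this
    rw [sub_self, rwKernel_zero]
    by_cases h : x = z <;> simp [h, sub_eq_zero]
  have h1 : HasSum (fun x => rwKernel (T m) (x - u j) * φ x) (φ' 0 (u j)) := by
    simpa using hφ 0 (u j)
  have h2 : HasSum (fun x => ∑ p with tm p < m, wave u T tm site (tm p) j (site p) *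
      (rwKernel (T m - T (tm p)) (x - site p) * φ x))
      (∑ p with tm p < m, wave u T tm site (tm p) j (site p) * φ' (T (tm p)) (site p)) :=
    hasSum_sum fun p _ => (hφ _ _).mul_left _
  have h3 : HasSum (fun x => ∑ p with tm p = m, if x = site p then
      wave u T tm site m j (site p) * φ (site p) else 0)
      (∑ p with tm p = m, wave u T tm site m j (site p) * φ (site p)) :=
    hasSum_sum fun p _ => hasSum_ite_eq (site p) _
  have h4 : ∑ p with tm p ≤ m, wave u T tm site (tm p) j (site p) * φ' (T (tm p)) (site p)
      = (∑ p with tm p < m, wave u T tm site (tm p) j (site p) * φ' (T (tm p)) (site p))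
        + ∑ p with tm p = m, wave u T tm site m j (site p) * φ (site p) := by
    rw [Finset.filter_congr (q := fun p => tm p < m ∨ tm p = m) fun p _ => le_iff_lt_or_eq,
      Finset.filter_or, Finset.sum_union]
    · congr 1
      refine Finset.sum_congr rfl fun p hp => ?_
      rw [(Finset.mem_filter.1 hp).2, hφm]
    · exact Finset.disjoint_filter.2 fun p _ h h' => h.ne h'
  rw [h4, ← sub_sub]
  refine hasSum_of_forall_eq (fun x => ?_) ((h1.sub h2).sub h3)
  have h5 : ∑ p with tm p = m, (if x = site p then
      wave u T tm site m j (site p) * φ (site p) else 0)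
      = (∑ p with tm p = m, if site p = x then (1 : ℝ) else 0) *
        (wave u T tm site m j x * φ x) := by
    rw [Finset.sum_mul]
    refine Finset.sum_congr rfl fun p _ => ?_
    by_cases h : x = site p
    · simp [h]
    · simp [h, Ne.symm h]
  rw [h5, freeSite_eq hinj]
  have h6 : rwKernel (T m) (x - u j) * φ x - ∑ p with tm p < m,
      wave u T tm site (tm p) j (site p) * (rwKernel (T m - T (tm p)) (x - site p) * φ x)
      = wave u T tm site m j x * φ x := by
    rw [hw x, sub_mul, Finset.sum_mul]
    simp only [mul_assoc]
  rw [h6]; ring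

theorem hasSum_rwKernel_sub_mul_rwKernel_sub (x y : ℤ) (s t r : ℝ) :
    HasSum (fun z => rwKernel (t - s) (z - x) * rwKernel (r - t) (y - z))
      (rwKernel (r - s) (y - x)) := by
  have := hasSum_rwKernel_mul_rwKernel (t - s) (r - t) x y
  rwa [show t - s + (r - t) = r - s by ring] at this

/-- The last-obstacle decomposition of a wave. -/
theorem wave_eq (hT : T 0 = 0) (hinj : ∀ p q, tm p = tm q → site p = site q → p = q) (m : ℕ)
    (j : Fin N) (x : ℤ) : wave u T tm site m j x = rwKernel (T m) (x - u j) -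
      ∑ p with tm p < m, wave u T tm site (tm p) j (site p) *
        rwKernel (T m - T (tm p)) (x - site p) := by
  induction m generalizing x with
  | zero => simp [wave, hT]
  | succ m ih =>
    have h := hasSum_wave_mul hinj ih (φ := fun z => rwKernel (T (m + 1) - T m) (x - z))
      (φ' := fun s z => rwKernel (T (m + 1) - s) (x - z))
      fun s z => hasSum_rwKernel_sub_mul_rwKernel_sub z x s (T m) (T (m + 1))
    simp only [Nat.lt_succ_iff]
    rw [wave, h.tsum_eq, sub_zero]

theorem hasSum_wave_mul_freeSite_mul (hT : T 0 = 0)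
    (hinj : ∀ p q, tm p = tm q → site p = site q → p = q) (m : ℕ) (j : Fin N) (y : ℤ) :
    HasSum (fun x => wave u T tm site m j x *
      (freeSite tm site m x * rwKernel (T (m + 1) - T m) (y - x)))
      (wave u T tm site (m + 1) j y) := by
  have h := hasSum_wave_mul (u := u) hinj (wave_eq hT hinj m j)
    (φ := fun z => rwKernel (T (m + 1) - T m) (y - z))
    (φ' := fun s z => rwKernel (T (m + 1) - s) (y - z))
    fun s z => hasSum_rwKernel_sub_mul_rwKernel_sub z y s (T m) (T (m + 1))
  rw [wave]
  exact h.summable.hasSum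

/-- The correlation kernel for the normalized heat kernel. -/
def rwCorrKernel (u : Fin N → ℤ) (s : ℝ) (x : ℤ) (t : ℝ) (y : ℤ) : ℝ :=
  ∑ j, rwKernel s (x - u j) * lagrangeHeat u j t y - if t < s then rwKernel (s - t) (x - y) else 0

/-- A block upper triangular matrix with unit diagonal blocks has determinant one. -/
theorem det_one_add_of_strict [DecidableEq ι] {U : Matrix ι ι ℝ}
    (hU : ∀ p q, tm q ≤ tm p → U p q = 0) : (1 + U).det = 1 := by
  have hb : (1 + U).BlockTriangular tm := fun p q h => by
    rw [Matrix.add_apply, hU p q h.le, Matrix.one_apply_ne (fun h' => h.ne' (by rw [h'])), add_zero]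
  rw [hb.det]
  refine Finset.prod_eq_one fun a _ => ?_
  rw [show (1 + U).toSquareBlock tm a = 1 from ?_, Matrix.det_one]
  ext p q
  rw [Matrix.toSquareBlock_def, Matrix.of_apply, Matrix.add_apply,
    hU _ _ (by rw [p.2, q.2]), add_zero, Matrix.one_apply, Matrix.one_apply]
  simp only [Subtype.ext_iff]

/-- The determinant over the particles equals a determinant over the obstacles
(Weinstein–Aronszajn). -/
theorem det_one_sub_wave [DecidableEq ι] (hT : T 0 = 0) (hTm : StrictMono T)
    (hinj : ∀ p q, tm p = tm q → site p = site q → p = q) :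
    (1 - Matrix.of fun j k => ∑ p, wave u T tm site (tm p) j (site p) *
      lagrangeHeat u k (T (tm p)) (site p)).det
    = (1 - Matrix.of fun p q =>
        rwCorrKernel u (T (tm p)) (site p) (T (tm q)) (site q)).det := by
  let A : Matrix (Fin N) ι ℝ := Matrix.of fun j p => wave u T tm site (tm p) j (site p)
  let A0 : Matrix (Fin N) ι ℝ := Matrix.of fun j p => rwKernel (T (tm p)) (site p - u j)
  let B : Matrix ι (Fin N) ℝ := Matrix.of fun p k => lagrangeHeat u k (T (tm p)) (site p)
  let U : Matrix ι ι ℝ := Matrix.of fun q p =>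
    if tm q < tm p then rwKernel (T (tm p) - T (tm q)) (site p - site q) else 0
  have hA : A * (1 + U) = A0 := by
    rw [Matrix.mul_add, Matrix.mul_one]
    ext j p
    rw [Matrix.add_apply, Matrix.mul_apply]
    simp only [A, A0, U, Matrix.of_apply, mul_ite, mul_zero]
    rw [← Finset.sum_filter, wave_eq (u := u) hT hinj (tm p) j (site p), sub_add_cancel]
  have hU : (1 + U).det = 1 := det_one_add_of_strict (tm := tm) fun p q h => by
    simp [U, not_lt.2 h]
  have h1 : (Matrix.of fun j k => ∑ p, wave u T tm site (tm p) j (site p) *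
      lagrangeHeat u k (T (tm p)) (site p)) = A * B := by
    ext j k; rw [Matrix.mul_apply]; rfl
  rw [h1, Matrix.det_one_sub_mul_comm]
  calc (1 - B * A).det = ((1 - B * A) * (1 + U)).det := by rw [Matrix.det_mul, hU, mul_one]
    _ = (1 + U - B * A0).det := by rw [Matrix.sub_mul, Matrix.one_mul, Matrix.mul_assoc, hA]
    _ = _ := by
      rw [← Matrix.det_transpose]
      congr 1
      ext p q
      simp only [Matrix.transpose_apply, Matrix.sub_apply, Matrix.add_apply, Matrix.mul_apply,
        Matrix.of_apply, rwCorrKernel, B, A0, U, hTm.lt_iff_lt]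
      rw [Matrix.one_apply, Matrix.one_apply]
      simp only [eq_comm (a := q), mul_comm (rwKernel _ _)]
      ring

end Wave

/-! ### Hole probabilities of the noncolliding walk -/

section Hole

variable {N : ℕ} {Ω : Type*} [MeasurableSpace Ω] {P : Measure Ω}
  {V : ℝ≥0 → Ω → Fin N → ℤ} {u : Fin N → ℤ} {Ω' : Type*} [MeasurableSpace Ω'] {P' : Measure Ω'}
  {X : ℝ≥0 → Ω' → Fin N → ℤ}

theorem hTransition_nonneg (t : ℝ≥0) {x y : Fin N → ℤ} (hx : x ∈ weylChamber N)
    (hy : y ∈ weylChamber N) : 0 ≤ hTransition P V t x y :=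
  mul_nonneg measureReal_nonneg
    (div_nonneg (vandermondeDet_pos hy).le (vandermondeDet_pos hx).le)

theorem IsNoncollidingRW.measure_path_succ [IsProbabilityMeasure P']
    (hX : IsNoncollidingRW P V u P' X) {τ : ℕ → ℝ≥0}
    (hτ : StrictMono τ) (hτ0 : τ 0 = 0) (m : ℕ) (z : ℕ → Fin N → ℤ)
    (hz : ∀ i ≤ m + 1, z i ∈ weylChamber N) :
    P' {ω | ∀ i ≤ m + 1, X (τ i) ω = z i} = P' {ω | ∀ i ≤ m, X (τ i) ω = z i} *
      ENNReal.ofReal (hTransition P V (τ (m + 1) - τ m) (z m) (z (m + 1))) := by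
  by_cases h0 : z 0 = u
  · have h : ∀ n ≤ m + 1, P'.real {ω | ∀ i ≤ n, X (τ i) ω = z i} = ∏ i ∈ Finset.range n,
        hTransition P V (τ (i + 1) - τ i) (z i) (z (i + 1)) := fun n hn => by
      have h1 := hX.markov n (fun i => τ i) (hτ.comp Fin.val_strictMono) (by simpa using hτ0)
        (fun i => z i) (by simpa using h0) fun i => hz i (by omega)
      rw [Finset.prod_range]
      refine Eq.trans ?_ h1
      congr 1
      ext ω
      exact ⟨fun h i => h i (Nat.le_of_lt_succ i.2), fun h i hi => h ⟨i, Nat.lt_succ_of_le hi⟩⟩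
    rw [← ofReal_measureReal (μ := P'), ← ofReal_measureReal (μ := P'), h _ le_rfl,
      h m (Nat.le_succ m), Finset.prod_range_succ,
      ENNReal.ofReal_mul (Finset.prod_nonneg fun i hi => ?_)]
    have := Finset.mem_range.1 hi
    exact hTransition_nonneg _ (hz i (by omega)) (hz (i + 1) (by omega))
  · have h : ∀ n, P' {ω | ∀ i ≤ n, X (τ i) ω = z i} = 0 := fun n => by
      refine measure_mono_null (fun ω (hω : ∀ i ≤ n, X (τ i) ω = z i) => ?_) hX.start
      intro (h : X 0 ω = u)
      rw [← hτ0, hω 0 (Nat.zero_le n)] at h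
      exact h0 h
    rw [h, h, zero_mul]

variable {ι : Type*} (tm : ι → ℕ) (site : ι → ℤ)

/-- The points of the Weyl chamber without a particle at the sites assigned to the time
index `m`. -/
def holeSet (N : ℕ) (m : ℕ) : Set (Fin N → ℤ) :=
  {x | x ∈ weylChamber N ∧ ∀ p, tm p = m → ∀ j, x j ≠ site p}

open scoped Classical in
theorem prod_freeSite {m : ℕ} {x : Fin N → ℤ} (hx : x ∈ weylChamber N) :
    ∏ j, freeSite tm site m (x j) = if x ∈ holeSet tm site N m then 1 else 0 := by
  split_ifs with h
  · refine Finset.prod_eq_one fun j _ => if_neg ?_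
    rintro ⟨p, hp, hpx⟩
    exact h.2 p hp j hpx.symm
  · have : ∃ p, tm p = m ∧ ∃ j, x j = site p := by
      by_contra! hcon
      exact h ⟨hx, fun p hp j => hcon p hp j⟩
    obtain ⟨p, hp, j, hj⟩ := this
    exact Finset.prod_eq_zero (Finset.mem_univ j) (if_pos ⟨p, hp, hj.symm⟩)

variable [Fintype ι] [IsProbabilityMeasure P] [IsProbabilityMeasure P']

/-- The probability that there are holes up to the time index `m`, the configuration at that time
being `y`, is a determinant of waves. -/
theorem measure_hole_eq_det (hV : IsRWVector P V) (hX : IsNoncollidingRW P V u P' X)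
    (hu : u ∈ weylChamber N) {τ : ℕ → ℝ≥0} (hτ : StrictMono τ) (hτ0 : τ 0 = 0)
    (hinj : ∀ p q, tm p = tm q → site p = site q → p = q) (m : ℕ) {y : Fin N → ℤ}
    (hy : y ∈ weylChamber N) :
    P'.real {ω | (∀ i ≤ m, X (τ i) ω ∈ holeSet tm site N i) ∧ X (τ m) ω = y}
      = (Matrix.of fun j k => wave u (fun i => (τ i : ℝ)) tm site m j (y k) *
          freeSite tm site m (y k)).det * (vandermondeDet y / vandermondeDet u) := by
  classical
  set T : ℕ → ℝ := fun i => (τ i : ℝ) with hTdef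
  have hT0 : T 0 = 0 := by simp [T, hτ0]
  have hdet : ∀ m (y : Fin N → ℤ), y ∈ weylChamber N → (Matrix.of fun j k =>
      wave u T tm site m j (y k) * freeSite tm site m (y k)).det
      = (if y ∈ holeSet tm site N m then 1 else 0) *
        (Matrix.of fun j k => wave u T tm site m j (y k)).det := fun m y hy => by
    rw [← prod_freeSite tm site hy, ← Matrix.det_mul_row]
    congr 1
    ext j k
    exact mul_comm _ _
  induction m generalizing y with
  | zero =>
    have hset : P'.real {ω | (∀ i ≤ 0, X (τ i) ω ∈ holeSet tm site N i) ∧ X (τ 0) ω = y}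
        = P'.real {_ω | u ∈ holeSet tm site N 0 ∧ u = y} := by
      refine measureReal_congr (eventuallyEq_set.2 ?_)
      filter_upwards [hX.start] with ω hω
      simp only [Nat.le_zero_eq, forall_eq, hτ0, hω]
    have hw : (Matrix.of fun j k => wave u T tm site 0 j (y k)).det = if u = y then 1 else 0 :=
      kmDet_zero hu hy
    rw [hset, hdet 0 y hy, hw]
    by_cases h1 : u = y
    · subst h1
      by_cases h2 : u ∈ holeSet tm site N 0
      · simp [h2, div_self (vandermondeDet_pos hu).ne']
      · simp [h2]
    · simp [h1]
  | succ m ih =>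
    by_cases hyC : y ∈ holeSet tm site N (m + 1)
    swap
    · rw [hdet _ y hy, if_neg hyC, zero_mul, zero_mul]
      convert measureReal_empty (μ := P')
      refine Set.eq_empty_of_forall_notMem ?_
      rintro ω ⟨h1, h2⟩
      exact hyC (h2 ▸ h1 (m + 1) le_rfl)
    have h := measure_stay_succ (P := P') (Y := fun i ω => X (τ i) ω) (W := weylChamber N)
      (m := m) (r := fun z y => ENNReal.ofReal (hTransition P V (τ (m + 1) - τ m) z y))
      (fun i => hX.measurable _) (fun z hz => hX.measure_path_succ hτ hτ0 m z hz)
      (C := holeSet tm site N) (fun _ _ hx => hx.1) hyC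
    rw [← tsum_subtype_eq_of_support_subset (s := weylChamber N)] at h
    swap
    · intro z hz
      by_contra hzW
      refine hz ?_
      have : {ω | (∀ i ≤ m, X (τ i) ω ∈ holeSet tm site N i) ∧ X (τ m) ω = z} = ∅ := by
        refine Set.eq_empty_of_forall_notMem ?_
        rintro ω ⟨h1, h2⟩
        exact hzW (h2 ▸ h1 m le_rfl).1
      simp only [this, measure_empty, zero_mul]
    have hne := h ▸ measure_ne_top P'
      {ω | (∀ i ≤ m + 1, X (τ i) ω ∈ holeSet tm site N i) ∧ X (τ (m + 1)) ω = y}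
    rw [measureReal_def, h, ENNReal.tsum_toReal_eq fun z => ENNReal.ne_top_of_tsum_ne_top hne z]
    have hδ : ((τ (m + 1) - τ m : ℝ≥0) : ℝ) = T (m + 1) - T m :=
      NNReal.coe_sub (hτ (Nat.lt_succ_self m)).le
    have hcb := hasSum_det_mul_det
      (A := fun j x => wave u T tm site m j x * freeSite tm site m x)
      (B := fun k x => rwKernel (T (m + 1) - T m) (y k - x))
      (C := Matrix.of fun j k => wave u T tm site (m + 1) j (y k)) fun j k =>
        hasSum_of_forall_eq (fun x => mul_assoc _ _ _)
          (hasSum_wave_mul_freeSite_mul hT0 hinj m j (y k))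
    rw [hdet _ y hy, if_pos hyC, one_mul, ← (hcb.mul_right _).tsum_eq]
    refine tsum_congr fun z => ?_
    rw [ENNReal.toReal_mul, ENNReal.toReal_ofReal (hTransition_nonneg _ z.2 hy)]
    have ihz := ih z.2
    rw [measureReal_def] at ihz
    rw [ihz, hTransition, absorbedTransition_eq_kmDet hV _ z.2 hy, hδ, kmDet,
      ← Matrix.det_transpose (Matrix.of fun k j => rwKernel (T (m + 1) - T m) (y k - z.1 j))]
    have hz0 := (vandermondeDet_pos z.2).ne'
    have hu0 := (vandermondeDet_pos hu).ne'
    rw [show (Matrix.of fun k j => rwKernel (T (m + 1) - T m) (y k - z.1 j)).transpose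
      = Matrix.of fun j k => rwKernel (T (m + 1) - T m) (y k - z.1 j) from rfl]
    field_simp

/-- The probability that given space-time points are not visited is a determinant of the
correlation kernel. -/
theorem measure_hole_eq_det_rwCorrKernel [DecidableEq ι] (hV : IsRWVector P V)
    (hX : IsNoncollidingRW P V u P' X) (hu : u ∈ weylChamber N) {τ : ℕ → ℝ≥0} (hτ : StrictMono τ)
    (hτ0 : τ 0 = 0) (hinj : ∀ p q, tm p = tm q → site p = site q → p = q) :
    P'.real {ω | ∀ p j, X (τ (tm p)) ω j ≠ site p} = (1 - Matrix.of fun p q =>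
      rwCorrKernel u (τ (tm p)) (site p) (τ (tm q)) (site q)).det := by
  classical
  obtain ⟨M, hM⟩ : ∃ M, ∀ p, tm p ≤ M :=
    ⟨Finset.univ.sup tm, fun p => Finset.le_sup (f := tm) (Finset.mem_univ p)⟩
  set T : ℕ → ℝ := fun i => (τ i : ℝ) with hTdef
  have hT0 : T 0 = 0 := by simp [T, hτ0]
  have hT : StrictMono T := fun i j hij => NNReal.coe_lt_coe.2 (hτ hij)
  have hset : P' {ω | ∀ p j, X (τ (tm p)) ω j ≠ site p}
      = P' {ω | ∀ i ≤ M, X (τ i) ω ∈ holeSet tm site N i} := by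
    refine measure_congr (eventuallyEq_set.2 ?_)
    filter_upwards [hX.mem_chamber] with ω hω
    refine ⟨fun h i _ => ⟨hω _, fun p hp j => ?_⟩, fun h p j => ?_⟩
    · subst hp; exact h p j
    · exact (h (tm p) (hM p)).2 p rfl j
  have hsum : P' {ω | ∀ i ≤ M, X (τ i) ω ∈ holeSet tm site N i} = ∑' y : weylChamber N,
      P' {ω | (∀ i ≤ M, X (τ i) ω ∈ holeSet tm site N i) ∧ X (τ M) ω = y.1} := by
    rw [measure_eq_tsum_inter_preimage_singleton P' (hX.measurable (τ M)),
      ← tsum_subtype_eq_of_support_subset (s := weylChamber N)]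
    · refine tsum_congr fun y => ?_
      congr 1
      ext ω
      exact and_comm
    · intro y hy
      by_contra hyW
      refine hy ?_
      convert measure_empty (μ := P')
      refine Set.eq_empty_of_forall_notMem ?_
      rintro ω ⟨h1, h2⟩
      have h3 : X (τ M) ω = y := h1
      exact hyW (h3 ▸ (h2 M le_rfl).1)
  have hne := hsum ▸ measure_ne_top P' {ω | ∀ i ≤ M, X (τ i) ω ∈ holeSet tm site N i}
  rw [measureReal_def, hset, hsum,
    ENNReal.tsum_toReal_eq fun y => ENNReal.ne_top_of_tsum_ne_top hne y]
  have hcb := hasSum_det_mul_det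
    (A := fun j x => wave u T tm site M j x * freeSite tm site M x)
    (B := fun k x => lagrangeHeat u k (T M) x)
    (C := 1 - Matrix.of fun j k => ∑ p, wave u T tm site (tm p) j (site p) *
      lagrangeHeat u k (T (tm p)) (site p)) fun j k => by
        have h1 := hasSum_wave_mul (u := u) hinj (wave_eq hT0 hinj M j)
          fun s z => hasSum_rwKernel_mul_lagrangeHeat u k s (T M) z
        rw [lagrangeHeat_zero, lagrangeProd_apply_node hu,
          Finset.filter_true_of_mem fun p _ => hM p] at h1
        rw [Matrix.sub_apply, Matrix.one_apply, Matrix.of_apply]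
        simp only [eq_comm (a := j)]
        exact hasSum_of_forall_eq (fun x => mul_assoc _ _ _) h1
  rw [← det_one_sub_wave hT0 hT hinj, ← hcb.tsum_eq]
  refine tsum_congr fun y => ?_
  rw [det_lagrangeHeat hu]
  exact measure_hole_eq_det tm site hV hX hu hτ hτ0 hinj M y.2

end Hole

/-! ### The kernel of modified Bessel functions -/

theorem besselI_natAbs_eq (t : ℝ) (k : ℤ) :
    besselI k.natAbs t = Real.exp t * rwKernel t k := by
  rw [rwKernel, ← mul_assoc, ← Real.exp_add, add_neg_cancel, Real.exp_zero, one_mul]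

theorem rwKernel_sub_comm (t : ℝ) (x y : ℤ) : rwKernel t (x - y) = rwKernel t (y - x) := by
  rw [← rwKernel_neg_right, neg_sub]

theorem kernelSummand_eq {N : ℕ} (u : Fin N → ℤ) (j : Fin N) (s : ℝ≥0) (x : ℤ) (t : ℝ≥0) (y : ℤ)
    (w : {w : ℤ // w ∉ Set.range u}) : kernelSummand u j s x t y w =
      Real.exp s * rwKernel s (x - u j) * Real.exp (-t) *
        (rwKernel (-t) (w.1 - y) * lagrangeProd u j w.1) := by
  rw [kernelSummand, besselI_natAbs_eq, besselI_natAbs_eq, rwKernel_sub_comm _ y]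
  ring

theorem summable_kernelSummand {N : ℕ} (u : Fin N → ℤ) (j : Fin N) (s : ℝ≥0) (x : ℤ) (t : ℝ≥0)
    (y : ℤ) : Summable (kernelSummand u j s x t y) := by
  have h := ((expGrowth_lagrangeProd u j).summable_abs (-t) y).of_abs
  have h2 := (h.comp_injective (Subtype.val_injective (p := fun w => w ∉ Set.range u))).mul_left
    (Real.exp s * rwKernel s (x - u j) * Real.exp (-t))
  exact h2.congr fun w => (kernelSummand_eq u j s x t y w).symm

/-- On the nodes `L_j` is a delta function, which leaves the sum over the other sites. -/
theorem lagrangeHeat_eq {N : ℕ} {u : Fin N → ℤ} (hu : StrictMono u) (j : Fin N) (t : ℝ) (y : ℤ) :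
    lagrangeHeat u j t y = rwKernel (-t) (u j - y) + ∑' w : {w : ℤ // w ∉ Set.range u},
      rwKernel (-t) (w.1 - y) * lagrangeProd u j w.1 := by
  set f : ℤ → ℝ := fun w => rwKernel (-t) (w - y) * lagrangeProd u j w with hf
  have hs : Summable f := ((expGrowth_lagrangeProd u j).summable_abs (-t) y).of_abs
  have h1 : HasSum (({w | w ∉ Set.range u} : Set ℤ).indicator f)
      (∑' w : {w : ℤ // w ∉ Set.range u}, f w.1) :=
    hasSum_subtype_iff_indicator.1
      (hs.comp_injective (Subtype.val_injective (p := fun w => w ∉ Set.range u))).hasSum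
  have h2 := (hasSum_ite_eq (u j) (rwKernel (-t) (u j - y))).add h1
  rw [← h2.tsum_eq]
  refine tsum_congr fun w => ?_
  by_cases hw : w ∈ Set.range u
  · obtain ⟨k, rfl⟩ := hw
    rw [Set.indicator_of_notMem (by simp), lagrangeProd_apply_node hu, add_zero]
    simp only [hu.injective.eq_iff, eq_comm (a := j)]
    split_ifs with h <;> simp [h]
  · rw [Set.indicator_of_mem (show w ∈ {w | w ∉ Set.range u} from hw),
      if_neg fun h => hw ⟨j, h.symm⟩, zero_add]

/-- The kernel of modified Bessel functions is conjugate to the one built from transition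
probabilities. -/
theorem besselKernel_eq {N : ℕ} {u : Fin N → ℤ} (hu : StrictMono u) (s : ℝ≥0) (x : ℤ) (t : ℝ≥0)
    (y : ℤ) : besselKernel u s x t y
      = Real.exp s * rwCorrKernel u s x t y * (Real.exp t)⁻¹ := by
  have h1 : ∀ j, besselI (x - u j).natAbs s * besselI (y - u j).natAbs (-(t : ℝ))
      + ∑' w : {w : ℤ // w ∉ Set.range u}, kernelSummand u j s x t y w
      = Real.exp s * (rwKernel s (x - u j) * lagrangeHeat u j t y) * (Real.exp t)⁻¹ := fun j => by
    simp only [kernelSummand_eq]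
    rw [tsum_mul_left, lagrangeHeat_eq hu, besselI_natAbs_eq, besselI_natAbs_eq,
      rwKernel_sub_comm _ y, Real.exp_neg]
    ring
  rw [besselKernel, ← Finset.sum_add_distrib, Finset.sum_congr rfl fun j _ => h1 j,
    ← Finset.sum_mul, ← Finset.mul_sum, rwCorrKernel]
  simp only [NNReal.coe_lt_coe]
  split_ifs with h
  · rw [besselI_natAbs_eq, Real.exp_sub]; ring
  · ring

/-- The conjugating factors `e^s` and `e^{-t}` cancel in the determinant. -/
theorem kernelDet_besselKernel {N : ℕ} {u : Fin N → ℤ} (hu : StrictMono u) {M : ℕ}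
    (t : Fin M → ℝ≥0) (x : SiteTuples M) : kernelDet (besselKernel u) t x
      = (Matrix.of fun p q : (Σ m, Fin (x.1 m)) =>
        rwCorrKernel u (t p.1) (x.2 p.1 p.2) (t q.1) (x.2 q.1 q.2)).det := by
  have h1 := Matrix.det_mul_column (fun p : (Σ m, Fin (x.1 m)) => Real.exp (t p.1)) (Matrix.of
    fun p q : (Σ m, Fin (x.1 m)) => rwCorrKernel u (t p.1) (x.2 p.1 p.2) (t q.1) (x.2 q.1 q.2) *
      (Real.exp (t q.1))⁻¹)
  have h2 := Matrix.det_mul_row (fun p : (Σ m, Fin (x.1 m)) => (Real.exp (t p.1))⁻¹) (Matrix.of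
    fun p q : (Σ m, Fin (x.1 m)) => rwCorrKernel u (t p.1) (x.2 p.1 p.2) (t q.1) (x.2 q.1 q.2))
  have h3 : (∏ p : (Σ m, Fin (x.1 m)), Real.exp (t p.1)) *
      ∏ p : (Σ m, Fin (x.1 m)), (Real.exp (t p.1))⁻¹ = 1 := by
    rw [← Finset.prod_mul_distrib]
    exact Finset.prod_eq_one fun p _ => mul_inv_cancel₀ (Real.exp_pos _).ne'
  simp only [Matrix.of_apply, mul_comm (Real.exp _)⁻¹] at h1 h2
  rw [kernelDet]
  simp only [besselKernel_eq hu, mul_assoc]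
  rw [h1, h2, ← mul_assoc, h3, one_mul]

/-! ### Correlation functions -/

/-- Inclusion–exclusion for determinants. -/
theorem det_eq_sum_det_one_sub_submatrix {ι : Type*} [Fintype ι] [DecidableEq ι]
    (K : Matrix ι ι ℝ) : K.det = ∑ s : Finset ι, (-1) ^ s.card *
      (1 - K.submatrix (Subtype.val : s → ι) (Subtype.val : s → ι)).det := by
  have h1 : K.det = ∑ s : Finset ι,
      (Matrix.of (s.piecewise (K - 1).row (1 : Matrix ι ι ℝ).row)).det := by
    have := (Matrix.detRowAlternating (R := ℝ) (n := ι)).map_add_univ (K - 1).row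
      (1 : Matrix ι ι ℝ).row
    rw [show (K - 1).row + (1 : Matrix ι ι ℝ).row = K from sub_add_cancel K 1] at this
    exact this
  rw [h1]
  refine Finset.sum_congr rfl fun s _ => ?_
  rw [Matrix.det_piecewise_one_eq_submatrix_det, ← neg_sub, Matrix.submatrix_neg, Pi.neg_apply,
    Pi.neg_apply, Matrix.det_neg, Fintype.card_coe]
  rw [Matrix.submatrix_sub, Pi.sub_apply, Pi.sub_apply,
    Matrix.submatrix_one _ Subtype.val_injective]

/-- Finitely many times are among the values of a strictly increasing sequence that starts at
`0`. -/
theorem exists_strictMono_nat_times {M : ℕ} (t : Fin M → ℝ≥0) :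
    ∃ τ : ℕ → ℝ≥0, StrictMono τ ∧ τ 0 = 0 ∧ ∃ e : Fin M → ℕ, ∀ m, τ (e m) = t m := by
  classical
  let F : Finset ℝ≥0 := insert 0 (Finset.univ.image t)
  have hF : 0 < F.card := Finset.card_pos.2 (Finset.insert_nonempty _ _)
  let g := F.orderEmbOfFin rfl
  have hg : ∀ i, g i ≤ F.sup id := fun i =>
    Finset.le_sup (f := id) (Finset.orderEmbOfFin_mem F rfl i)
  let τ : ℕ → ℝ≥0 := fun i => if h : i < F.card then g ⟨i, h⟩ else F.sup id + i
  have hsurj : ∀ a ∈ F, ∃ i : Fin F.card, g i = a := fun a ha => by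
    have : a ∈ Set.range g := by rw [Finset.range_orderEmbOfFin]; exact ha
    exact this
  refine ⟨τ, fun i j hij => ?_, ?_, ?_⟩
  · by_cases hj : j < F.card
    · have hi := hij.trans hj
      simp only [τ, hi, hj, dite_true]
      exact g.strictMono hij
    · by_cases hi : i < F.card
      · simp only [τ, hi, hj, dite_true, dite_false]
        refine (hg _).trans_lt (lt_add_of_pos_right _ ?_)
        exact_mod_cast hF.trans_le (not_lt.1 hj)
      · simp only [τ, hi, hj, dite_false]
        gcongr
  · obtain ⟨i, hi⟩ := hsurj 0 (Finset.mem_insert_self _ _)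
    simp only [τ, hF, dite_true]
    refine le_antisymm ?_ (zero_le)
    rw [← hi]
    exact g.monotone (Fin.mk_le_of_le_val (Nat.zero_le _))
  · have h2 : ∀ m, ∃ i : Fin F.card, g i = t m := fun m =>
      hsurj _ (Finset.mem_insert_of_mem (Finset.mem_image_of_mem _ (Finset.mem_univ m)))
    choose e he using h2
    refine ⟨fun m => e m, fun m => ?_⟩
    simp only [τ, (e m).2, dite_true, Fin.eta]
    exact he m

section Config

variable {N : ℕ} {Ω' : Type*} {X : ℝ≥0 → Ω' → Fin N → ℤ}

theorem configuration_real_singleton (t : ℝ≥0) (ω : Ω') (x : ℤ) :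
    (configuration X t ω).real {x} = ∑ j, if X t ω j = x then 1 else 0 := by
  rw [configuration, measureReal_def, Measure.finsetSum_apply, ENNReal.toReal_sum]
  · refine Finset.sum_congr rfl fun j _ => ?_
    rw [Measure.dirac_apply' _ (measurableSet_singleton x)]
    by_cases h : X t ω j = x <;> simp [h]
  · intro j _
    exact measure_ne_top _ _

theorem integral_configuration (t : ℝ≥0) (ω : Ω') (f : ℤ → ℝ) :
    ∫ x, f x ∂(configuration X t ω) = ∑ j, f (X t ω j) := by
  rw [configuration, integral_finsetSum_measure]
  · simp
  · intro j _
    exact integrable_dirac (by simp)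

open scoped Classical in
theorem configuration_real_singleton_of_injective {t : ℝ≥0} {ω : Ω'}
    (h : Function.Injective (X t ω)) (x : ℤ) :
    (configuration X t ω).real {x} = if ∃ j, X t ω j = x then 1 else 0 := by
  rw [configuration_real_singleton]
  split_ifs with hx
  · obtain ⟨j, rfl⟩ := hx
    simp [h.eq_iff]
  · exact Finset.sum_eq_zero fun j _ => if_neg fun hj => hx ⟨j, hj⟩

end Config

section Main

variable {N : ℕ} {Ω : Type*} [MeasurableSpace Ω] {P : Measure Ω} [IsProbabilityMeasure P]
  {V : ℝ≥0 → Ω → Fin N → ℤ} {u : Fin N → ℤ} {Ω' : Type*} [MeasurableSpace Ω'] {P' : Measure Ω'}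
  [IsProbabilityMeasure P'] {X : ℝ≥0 → Ω' → Fin N → ℤ}

/-- The spatio-temporal correlation functions are determinants of the kernel, by inclusion–exclusion
from the hole probabilities. -/
theorem correlation_eq_kernelDet (hu : StrictMono u) (hV : IsRWVector P V)
    (hX : IsNoncollidingRW P V u P' X) {M : ℕ} {t : Fin M → ℝ≥0} (ht : StrictMono t)
    (x : SiteTuples M) :
    correlation P' (configuration X) t x = kernelDet (besselKernel u) t x := by
  classical
  -- the walk is observed along a sequence of times that starts at `0`, where its position is known
  obtain ⟨τ, hτ, hτ0, e, he⟩ := exists_strictMono_nat_times t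
  let ι := Σ m, Fin (x.1 m)
  let H : ι → Set Ω' := fun p => {ω | ∀ j, X (t p.1) ω j ≠ x.2 p.1 p.2}
  have hHm : ∀ p, MeasurableSet (H p) := fun p =>
    hX.measurable (t p.1) (Set.to_countable {y : Fin N → ℤ | ∀ j, y j ≠ x.2 p.1 p.2}).measurableSet
  have hhole : ∀ s : Finset ι, P'.real (⋂ p ∈ s, H p) = (1 - (Matrix.of fun p q : ι =>
      rwCorrKernel u (t p.1) (x.2 p.1 p.2) (t q.1) (x.2 q.1 q.2)).submatrix
        (Subtype.val : s → ι) (Subtype.val : s → ι)).det := by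
    intro s
    have h := measure_hole_eq_det_rwCorrKernel (ι := s) (fun p => e p.1.1)
      (fun p => x.2 p.1.1 p.1.2) hV hX hu hτ hτ0 (by
        rintro ⟨⟨m, i⟩, hp⟩ ⟨⟨n, k⟩, hq⟩ h1 h2
        have hmn : m = n := ht.injective (by rw [← he m, ← he n]; exact congrArg τ h1)
        subst hmn
        have hik : i = k := (x.2 m).injective h2
        subst hik
        rfl)
    simp only [he] at h
    refine Eq.trans ?_ h
    congr 1
    ext ω
    simp [H]
  have hprod : ∀ᵐ ω ∂P', ∏ m, ∏ j, (configuration X (t m) ω).real {x.2 m j}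
      = ∑ s : Finset ι, (-1) ^ s.card * (⋂ p ∈ s, H p).indicator 1 ω := by
    filter_upwards [hX.mem_chamber] with ω hω
    rw [Finset.prod_sigma' Finset.univ (fun _ => Finset.univ)
      fun m j => (configuration X (t m) ω).real {x.2 m j}]
    have h1 : ∀ p : ι, (configuration X (t p.1) ω).real {x.2 p.1 p.2}
        = 1 + -(H p).indicator 1 ω := fun p => by
      rw [configuration_real_singleton_of_injective (StrictMono.injective (hω (t p.1)))]
      by_cases h : ω ∈ H p
      · have h' : ∀ j, X (t p.1) ω j ≠ x.2 p.1 p.2 := h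
        rw [Set.indicator_of_mem h, if_neg (by simpa using h')]
        simp
      · have h' : ¬ ∀ j, X (t p.1) ω j ≠ x.2 p.1 p.2 := h
        rw [Set.indicator_of_notMem h, if_pos (by simpa using h')]
        simp
    rw [Finset.univ_sigma_univ, Finset.prod_congr rfl fun p _ => h1 p, Finset.prod_one_add,
      Finset.powerset_univ]
    refine Finset.sum_congr rfl fun s _ => ?_
    rw [Finset.prod_neg]
    congr 1
    by_cases h : ω ∈ ⋂ p ∈ s, H p
    · rw [Set.indicator_of_mem h]
      exact Finset.prod_eq_one fun p hp => Set.indicator_of_mem (Set.mem_iInter₂.1 h p hp) _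
    · rw [Set.indicator_of_notMem h]
      simp only [Set.mem_iInter, not_forall] at h
      obtain ⟨p, hp, hpω⟩ := h
      exact Finset.prod_eq_zero hp (Set.indicator_of_notMem hpω _)
  have hHsm : ∀ s : Finset ι, MeasurableSet (⋂ p ∈ s, H p) := fun s =>
    Finset.measurableSet_biInter s fun p _ => hHm p
  rw [correlation, integral_congr_ae hprod, integral_finsetSum, kernelDet_besselKernel hu,
    det_eq_sum_det_one_sub_submatrix]
  · refine Finset.sum_congr rfl fun s _ => ?_
    rw [integral_const_mul, integral_indicator_one (hHsm s), hhole]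
  · intro s _
    exact ((integrable_const (1 : ℝ)).indicator (hHsm s)).const_mul _

/-! ### The Fredholm expansion -/

/-- The increasing enumerations of finite sets of sites, one set for each time. -/
def siteTuplesOfFinset {M : ℕ} (T : Fin M → Finset ℤ) : SiteTuples M :=
  ⟨fun m => (T m).card, fun m => (T m).orderEmbOfFin rfl⟩

theorem siteTuplesOfFinset_bijective (M : ℕ) :
    Function.Bijective (siteTuplesOfFinset : (Fin M → Finset ℤ) → SiteTuples M) := by
  constructor
  · intro S T h
    have key : ∀ (T : Fin M → Finset ℤ) m, (T m : Set ℤ) =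
        Set.range ((siteTuplesOfFinset T).2 m) := fun T m =>
      (Finset.range_orderEmbOfFin (T m) rfl).symm
    funext m
    rw [← Finset.coe_inj, key, key, h]
  · rintro ⟨n, x⟩
    -- stated for an arbitrary `n`, so that the equality of cardinalities can be substituted
    have hcard : ∀ (T : Fin M → Finset ℤ) (n : Fin M → ℕ) (h : ∀ m, (T m).card = n m),
        siteTuplesOfFinset T = ⟨n, fun m => (T m).orderEmbOfFin (h m)⟩ := by
      intro T n h
      obtain rfl : (fun m => (T m).card) = n := funext h
      rfl
    refine ⟨fun m => Finset.univ.map (x m).toEmbedding, ?_⟩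
    rw [hcard _ n fun m => by simp]
    congr 1
    funext m
    exact (Finset.orderEmbOfFin_unique' _ fun i => by simp).symm

instance (M : ℕ) : Countable (SiteTuples M) :=
  (siteTuplesOfFinset_bijective M).surjective.countable

theorem hasSum_siteTuples_prod {M : ℕ} (b : Fin M → ℤ → ℝ) (S : Fin M → Finset ℤ)
    (hb : ∀ m, ∀ k ∉ S m, b m k = 0) :
    HasSum (fun x : SiteTuples M => ∏ m, ∏ j, b m (x.2 m j)) (∏ m, ∏ k ∈ S m, (1 + b m k)) := by
  rw [← (Equiv.ofBijective _ (siteTuplesOfFinset_bijective M)).hasSum_iff]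
  have h1 : ∀ T : Fin M → Finset ℤ, ∏ m, ∏ j, b m ((siteTuplesOfFinset T).2 m j)
      = ∏ m, ∏ k ∈ T m, b m k := fun T => by
    refine Finset.prod_congr rfl fun m _ => ?_
    conv_rhs => rw [← Finset.map_orderEmbOfFin_univ (T m) rfl, Finset.prod_map]
    rfl
  have h2 : ∏ m, ∏ k ∈ S m, (1 + b m k)
      = ∑ T ∈ Fintype.piFinset fun m => (S m).powerset, ∏ m, ∏ k ∈ T m, b m k := by
    rw [← Finset.prod_univ_sum (fun m => (S m).powerset) fun m T => ∏ k ∈ T, b m k]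
    exact Finset.prod_congr rfl fun m _ => Finset.prod_one_add _
  rw [h2]
  refine hasSum_of_forall_eq (g := fun T : Fin M → Finset ℤ => ∏ m, ∏ k ∈ T m, b m k) h1 ?_
  refine hasSum_sum_of_ne_finset_zero fun T hT => ?_
  simp only [Fintype.mem_piFinset, Finset.mem_powerset, not_forall] at hT
  obtain ⟨m, hm⟩ := hT
  obtain ⟨k, hk, hkS⟩ := Finset.not_subset.1 hm
  exact Finset.prod_eq_zero (Finset.mem_univ m) (Finset.prod_eq_zero hk (hb m k hkS))

/-- For a configuration without multiple points, `∏ (1 + a)` over its points expands into a sum over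
its finite subsets. -/
theorem hasSum_siteTuples_configuration {Ω' : Type*} {X : ℝ≥0 → Ω' → Fin N → ℤ} {M : ℕ}
    (t : Fin M → ℝ≥0) {ω : Ω'} (hω : ∀ m, Function.Injective (X (t m) ω)) (a : Fin M → ℤ → ℝ) :
    HasSum (fun x : SiteTuples M => (∏ m, ∏ j, a m (x.2 m j)) *
      ∏ m, ∏ j, (configuration X (t m) ω).real {x.2 m j})
      (∏ m, ∏ j, (1 + a m (X (t m) ω j))) := by
  classical
  have h := hasSum_siteTuples_prod (fun m k => a m k * (configuration X (t m) ω).real {k})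
    (fun m => Finset.univ.image (X (t m) ω)) fun m k hk => by
      rw [configuration_real_singleton_of_injective (hω m), if_neg, mul_zero]
      simpa using hk
  convert h using 1
  · funext x
    simp only [Finset.prod_mul_distrib]
  · refine Finset.prod_congr rfl fun m _ => ?_
    rw [Finset.prod_image fun i _ j _ hij => hω m hij]
    refine Finset.prod_congr rfl fun j _ => ?_
    rw [configuration_real_singleton_of_injective (hω m), if_pos ⟨j, rfl⟩, mul_one]

/-- The moment generating function is the Fredholm determinant of the kernel, by termwise
integration of the expansion of `∏ (1 + χ_m)` over the configuration. -/
theorem isDeterminantal_besselKernel (hu : StrictMono u) (hV : IsRWVector P V)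
    (hX : IsNoncollidingRW P V u P' X) :
    IsDeterminantal P' (configuration X) (besselKernel u) := by
  intro M t ht f hf
  let χ : Fin M → ℤ → ℝ := fun m k => Real.exp (f m k) - 1
  let occ : SiteTuples M → Ω' → ℝ := fun x ω =>
    ∏ m, ∏ j, (configuration X (t m) ω).real {x.2 m j}
  have hocc0 : ∀ x ω, 0 ≤ occ x ω := fun x ω =>
    Finset.prod_nonneg fun m _ => Finset.prod_nonneg fun j _ => measureReal_nonneg
  have hXm : ∀ (m : Fin M) (φ : (Fin N → ℤ) → ℝ), Measurable fun ω => φ (X (t m) ω) := fun m φ =>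
    (measurable_of_countable φ).comp (hX.measurable (t m))
  have hoccm : ∀ x, Measurable (occ x) := fun x => by
    refine Finset.measurable_prod _ fun m _ => Finset.measurable_prod _ fun j _ => ?_
    simp only [configuration_real_singleton]
    exact hXm m fun y => ∑ j', if y j' = x.2 m j then 1 else 0
  have hinj : ∀ᵐ ω ∂P', ∀ m, Function.Injective (X (t m) ω) := by
    filter_upwards [hX.mem_chamber] with ω hω m using StrictMono.injective (hω (t m))
  let bound : SiteTuples M → Ω' → ℝ := fun x ω => (∏ m, ∏ j, |χ m (x.2 m j)|) * occ x ω
  have hbsum : ∀ᵐ ω ∂P', HasSum (fun x => bound x ω) (∏ m, ∏ j, (1 + |χ m (X (t m) ω j)|)) := by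
    filter_upwards [hinj] with ω hω
    exact hasSum_siteTuples_configuration t hω fun m k => |χ m k|
  have hone : ∀ m k, 1 + |χ m k| ≤ 2 * Real.exp (max (f m k) 0) := fun m k => by
    have h1 : Real.exp (f m k) ≤ Real.exp (max (f m k) 0) := Real.exp_le_exp.2 (le_max_left _ _)
    have h2 : 1 ≤ Real.exp (max (f m k) 0) := Real.one_le_exp (le_max_right _ _)
    have h3 := Real.exp_pos (f m k)
    have h4 : |χ m k| ≤ 2 * Real.exp (max (f m k) 0) - 1 :=
      abs_le.2 ⟨by simp only [χ]; linarith, by simp only [χ]; linarith⟩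
    linarith
  have hint : Integrable (fun ω => ∏ m, ∏ j, (1 + |χ m (X (t m) ω j)|)) P' := by
    refine Integrable.mono' (hf.const_mul (∏ _m : Fin M, ∏ _j : Fin N, (2 : ℝ))) ?_
      (Eventually.of_forall fun ω => ?_)
    · refine (Finset.measurable_prod _ fun m _ => ?_).aestronglyMeasurable
      exact hXm m fun y => ∏ j, (1 + |χ m (y j)|)
    · rw [Real.norm_of_nonneg (Finset.prod_nonneg fun _ _ => Finset.prod_nonneg fun _ _ =>
        by positivity)]
      simp only [integral_configuration, Real.exp_sum]
      rw [← Finset.prod_mul_distrib]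
      refine Finset.prod_le_prod (fun _ _ => Finset.prod_nonneg fun _ _ => by positivity)
        fun m _ => ?_
      rw [← Finset.prod_mul_distrib]
      exact Finset.prod_le_prod (fun _ _ => by positivity) fun j _ => hone m _
  have hmain := hasSum_integral_of_dominated_convergence (μ := P')
    (F := fun x ω => (∏ m, ∏ j, χ m (x.2 m j)) * occ x ω)
    (f := fun ω => Real.exp (∑ m, ∫ x, f m x ∂(configuration X (t m) ω))) bound
    (fun x => ((hoccm x).const_mul _).aestronglyMeasurable)
    (fun x => Eventually.of_forall fun ω => by
      rw [norm_mul, Real.norm_of_nonneg (hocc0 x ω)]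
      simp only [Real.norm_eq_abs, bound, Finset.abs_prod, le_refl])
    (hbsum.mono fun ω h => h.summable)
    (hint.congr (hbsum.mono fun ω h => h.tsum_eq.symm)) (by
      filter_upwards [hinj] with ω hω
      have h := hasSum_siteTuples_configuration t hω χ
      simp only [integral_configuration, Real.exp_sum]
      simpa only [χ, add_sub_cancel] using h)
  refine hasSum_of_forall_eq (fun x => ?_) hmain
  rw [integral_const_mul, ← correlation_eq_kernelDet hu hV hX ht x]
  rfl

end Main

end NoncollidingRW

end

theorem mainTheorem1 {N : ℕ} (hN : 0 < N) (u : Fin N → ℤ) (hu : StrictMono u)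
    {Ω : Type*} [MeasurableSpace Ω] (P : Measure Ω) [IsProbabilityMeasure P]
    (V : ℝ≥0 → Ω → Fin N → ℤ) (hV : NoncollidingRW.IsRWVector P V)
    {Ω' : Type*} [MeasurableSpace Ω'] (P' : Measure Ω') [IsProbabilityMeasure P']
    (X : ℝ≥0 → Ω' → Fin N → ℤ) (hX : NoncollidingRW.IsNoncollidingRW P V u P' X) :
    (∀ (j : Fin N) (s : ℝ≥0) (x : ℤ) (t : ℝ≥0) (y : ℤ),
      Summable (NoncollidingRW.kernelSummand u j s x t y)) ∧
    NoncollidingRW.IsDeterminantal P' (NoncollidingRW.configuration X)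
      (NoncollidingRW.besselKernel u) ∧
    (∀ (M : ℕ) (t : Fin M → ℝ≥0), StrictMono t → ∀ x : NoncollidingRW.SiteTuples M,
      NoncollidingRW.correlation P' (NoncollidingRW.configuration X) t x
        = NoncollidingRW.kernelDet (NoncollidingRW.besselKernel u) t x) := by
  exact ⟨NoncollidingRW.summable_kernelSummand u,
    NoncollidingRW.isDeterminantal_besselKernel hu hV hX,
    fun _ _ ht x => NoncollidingRW.correlation_eq_kernelDet hu hV hX ht x⟩
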